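/- Let $\mu>1$, $\lambda_0>1$, $\rho=1/\lambda_0$, and let $d\ge 0$ be an integer. Consider the following meal-delivery system. Orders arrive at a restaurant in a Poisson process of rate $1$ and join a processing queue. The restaurant prepares them one at a time, first come first served, with independent exponential preparation times of rate $\mu$. A prepared order joins a second queue, where it waits for a rider. The restaurant discloses no information (threshold $M=\infty$), so the platform dispatches riders at the instants of a Poisson process of constant rate $\lambda_0$, except that no rider is sent at an instant at which $d$ riders are already waiting at the restaurant (buffer length $d$). A rider who is sent arrives at once. The order arrivals, the preparation times and the dispatch instants are independent. Prepared orders and riders are matched first come first served: an arriving rider takes the earliest prepared waiting order, or waits if there is none; when an order becomes ready while riders are waiting, the earliest arrived rider takes it. The system starts at time $0$ with any number $q_1\ge 0$ of orders in the processing queue and any value $q_2\ge -d$ of the second queue ($q_2$ prepared orders if $q_2\ge 0$, and $-q_2$ waiting riders if $q_2<0$). The waiting time of an order is the time from its arrival at the restaurant (time $0$ for the orders initially in the processing queue) until a rider fetches it. The waiting time of a rider is the time from his or her arrival at the restaurant until he or she fetches an order. Let $\mathbb{E}[T_o]$ be the long-run average, over successive orders passing through the processing queue, of the order waiting times, and let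 $\mathbb{E}[T_r]$ be the long-run average, over the successive riders sent after time $0$, of the rider waiting times. Then, almost surely, both long-run averages exist, and $$\mathbb{E}[T_o]=\frac{1}{\mu-1}+\frac{\rho^{d+1}}{1-\rho},\qquad \mathbb{E}[T_r]=d-\frac{\rho-\rho^{d+1}}{1-\rho}.$$ -/

import Mathlib

open MeasureTheory ProbabilityTheory Filter Topology

noncomputable section

namespace MealDelivery

/-- The time of the `n`-th event (`n = 0, 1, …`) of a point process on `(0, ∞)` whose
successive gaps are `g 0, g 1, …`. -/
def eventTime (g : ℕ → ℝ) (n : ℕ) : ℝ := ∑ i ∈ Finset.range (n + 1), g i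

/-- One realization of the input of the meal-delivery system when the restaurant discloses
nothing (`M = ∞`, so the signal is constantly `0` and the dispatch rate is constantly `λ₀`):
the buffer length, the state at time `0` and the three sequences of random clocks. -/
structure Realization where
  /-- the buffer length `d` -/
  d : ℕ
  /-- `Q₁(0)`: the number of orders in the processing queue at time `0` -/
  q₁ : ℕ
  /-- `Q₂(0)`: the number of prepared orders waiting for riders at time `0`, or minus the
  number of riders waiting for orders -/
  q₂ : ℤ
  /-- the gaps of the order arrival process -/
  orderGap : ℕ → ℝ
  /-- `service k` is the preparation time of the `k`-th order -/
  service : ℕ → ℝ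
  /-- the gaps of the process of dispatch instants -/
  riderGap : ℕ → ℝ

namespace Realization

variable (x : Realization)

/-- The arrival time of order `k`. Orders are numbered in the order in which they pass through
the processing queue, so the first `q₁` are those that are there at time `0`; their waiting is
measured from time `0`. -/
def orderArrival (k : ℕ) : ℝ :=
  if k < x.q₁ then 0 else eventTime x.orderGap (k - x.q₁)

/-- The time at which order `k` is prepared. The restaurant works first come first served, on
one order at a time: it starts order `k + 1` as soon as this order has arrived and order `k`
is done. -/
def orderReady : ℕ → ℝ
  | 0 => x.orderArrival 0 + x.service 0
  | k + 1 => max (x.orderArrival (k + 1)) (orderReady k) + x.service (k + 1)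

/-- The number of orders whose preparation is completed in the time interval `(0, t)`. -/
def preparedBefore (t : ℝ) : ℕ := {k : ℕ | x.orderReady k < t}.ncard

/-- The `j`-th instant at which the platform is going to send a rider. -/
def dispatchInstant (j : ℕ) : ℝ := eventTime x.riderGap j

/-- The number of riders that are really sent at the dispatch instants `0, …, j - 1`.
At instant `j` a rider is sent if and only if fewer than `d` riders are waiting, that is
`Q₂ > -d` just before this instant. -/
def sentBefore : ℕ → ℕ
  | 0 => 0
  | j + 1 =>
    if -(x.d : ℤ) < x.q₂ + x.preparedBefore (x.dispatchInstant j) - sentBefore j then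
      sentBefore j + 1
    else sentBefore j

/-- The value of `Q₂` just before the dispatch instant `j`. -/
def queueTwoBefore (j : ℕ) : ℤ :=
  x.q₂ + x.preparedBefore (x.dispatchInstant j) - x.sentBefore j

/-- A rider is really sent at the dispatch instant `j`. -/
def Sent (j : ℕ) : Prop := -(x.d : ℤ) < x.queueTwoBefore j

/-- The arrival time at the restaurant of the `i`-th rider that is sent after time `0`
(a rider arrives as soon as the platform sends him or her). -/
def riderArrival (i : ℕ) : ℝ := x.dispatchInstant (Nat.nth x.Sent i)

/-- The arrival time (time `0` if present at time `0`) of the rider who takes order `k`.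
Orders and riders are matched first come first served. So if `q₂ ≥ 0`, the first `q₂` riders
take the orders that are prepared at time `0`, and order `k` is taken by rider `k + q₂`;
if `q₂ < 0`, the `-q₂` riders present at time `0` take the first `-q₂` orders, and rider
`k + q₂` takes order `k` from then on. -/
def riderOfOrderArrival (k : ℕ) : ℝ :=
  if (k : ℤ) + x.q₂ < 0 then 0 else x.riderArrival ((k : ℤ) + x.q₂).toNat

/-- The time at which order `k` is fetched: the order is prepared and its rider is present. -/
def orderFetched (k : ℕ) : ℝ := max (x.orderReady k) (x.riderOfOrderArrival k)

/-- The waiting time of order `k`, from its arrival at the restaurant until it is fetched. -/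
def orderWaiting (k : ℕ) : ℝ := x.orderFetched k - x.orderArrival k

/-- The time at which rider `i` fetches an order: order `i - q₂`, or, if this number is
negative, one of the orders that are prepared at time `0`. -/
def riderFetch (i : ℕ) : ℝ :=
  if (i : ℤ) - x.q₂ < 0 then x.riderArrival i
  else max (x.orderReady ((i : ℤ) - x.q₂).toNat) (x.riderArrival i)

/-- The waiting time of rider `i`, from his or her arrival until he or she fetches an order. -/
def riderWaiting (i : ℕ) : ℝ := x.riderFetch i - x.riderArrival i

end Realization

/-- The average of `w 0, w 1, …` over all indices exists and is `m`. -/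
def HasLongRunAverage (w : ℕ → ℝ) (m : ℝ) : Prop :=
  Tendsto (fun n : ℕ => (∑ k ∈ Finset.range n, w k) / n) atTop (𝓝 m)

end MealDelivery

end

noncomputable section

namespace MealDelivery

open Set

/-! ### The exponential distribution -/

/-! Measure the second queue by `Q₂ + d`. A dispatch instant then sends a rider exactly when this
queue is nonempty, so it is a single-server queue: its customers are `q₂ + d` initial ones followed
by the prepared orders, and its departures are the riders sent. The departure belonging to order `k`
is rider `q₂ + d + k`, and this rider takes order `k + d`. If `V` is the sojourn time of order `k`
in this queue and `G` the time between the completions of orders `k` and `k + d`, then order `k + d`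
waits `(V - G)⁺` after its preparation and the rider waits `(G - V)⁺`.

Since a Poisson process restarts afresh, the services of the second queue are independent
exponential variables of rate `l₀`, whatever the arrival times (`measurePreserving_restart`,
`measurePreserving_draw`). By Burke's theorem (`measurePreserving_burke`) a stationary first queue
has independent exponential departure gaps of rate 1. So the stationary second queue is again M/M/1:
`V` is exponential of rate `l₀ - 1` and independent of the `d` following gaps, whose sum is `G`.
Hence `E (V - G)⁺ = E exp(-(l₀ - 1) G) / (l₀ - 1) = ρ ^ d / (l₀ - 1)`, and `(G - V)⁺ = (V - G)⁺ - V
+ G` gives the mean for riders. The first queue contributes its mean sojourn time `1 / (μ - 1)`.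

For long-run averages in stationarity (`ae_longRunAverage_queue`), the queue is compared with one
that was empty `r` steps earlier. The latter depends on finitely many inputs, so the strong law
applies to it; the maximal ergodic inequality bounds the accumulated error. The initial state does
not matter: two Lindley recursions with the same inputs merge after finitely many steps
(`eventually_eq_of_lindley`), so the actual system eventually coincides with a stationary one driven
by the same clocks (`eventually_coupled`). -/

lemma expMeasure_Ioi {r : ℝ} (hr : 0 < r) {t : ℝ} (ht : 0 ≤ t) :
    expMeasure r (Ioi t) = ENNReal.ofReal (Real.exp (-(r * t))) := by
  have := isProbabilityMeasure_expMeasure hr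
  have h := cdf_expMeasure_eq hr t
  rw [if_pos ht, cdf_eq_real] at h
  rw [← compl_Iic, prob_compl_eq_one_sub measurableSet_Iic, ← ofReal_measureReal, h,
    ← ENNReal.ofReal_one, ← ENNReal.ofReal_sub _ (by simp; positivity)]
  ring_nf

lemma expMeasure_ae_pos {r : ℝ} (hr : 0 < r) : ∀ᵐ x ∂(expMeasure r), 0 < x := by
  have := isProbabilityMeasure_expMeasure hr
  refine (mem_ae_iff_prob_eq_one measurableSet_Ioi (s := Ioi (0 : ℝ))).2 ?_
  rw [expMeasure_Ioi hr le_rfl]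
  simp

/-- Both sides are finite measures, so it suffices to compare total masses and half-lines `Ioi x`,
where the claim is the functional equation of the exponential. -/
lemma expMeasure_memoryless {r : ℝ} (hr : 0 < r) {t : ℝ} (ht : 0 ≤ t) :
    (expMeasure r).restrict (Ioi t) =
      ENNReal.ofReal (Real.exp (-(r * t))) • (expMeasure r).map (· + t) := by
  have := isProbabilityMeasure_expMeasure hr
  have hp : ∀ x : ℝ, expMeasure r (Ioi x) = ENNReal.ofReal (Real.exp (-(r * max x 0))) := by
    intro x
    rcases le_total 0 x with h | h
    · rw [max_eq_left h, expMeasure_Ioi hr h]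
    · rw [max_eq_right h, mul_zero, neg_zero, Real.exp_zero, ENNReal.ofReal_one]
      refine le_antisymm prob_le_one ?_
      have h0 := expMeasure_Ioi hr (le_refl (0:ℝ))
      simp only [mul_zero, neg_zero, Real.exp_zero, ENNReal.ofReal_one] at h0
      rw [← h0]
      exact measure_mono (Ioi_subset_Ioi h)
  have h1 : ∀ x, (expMeasure r).restrict (Ioi t) (Ioi x)
      = (ENNReal.ofReal (Real.exp (-(r * t))) • (expMeasure r).map (· + t)) (Ioi x) := by
    intro x
    rw [Measure.restrict_apply measurableSet_Ioi, Ioi_inter_Ioi, Measure.smul_apply,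
      Measure.map_apply (by fun_prop) measurableSet_Ioi]
    have : (fun y : ℝ => y + t) ⁻¹' Ioi x = Ioi (x - t) := by ext; simp [sub_lt_iff_lt_add]
    rw [this, hp, hp, smul_eq_mul, ← ENNReal.ofReal_mul (Real.exp_nonneg _), ← Real.exp_add]
    congr 2
    have : x ⊔ t ⊔ 0 = t + (x - t) ⊔ 0 := by
      rcases le_total x t with h | h
      · rw [max_eq_right h, max_eq_left ht, max_eq_right (by linarith)]; ring
      · rw [max_eq_left h, max_eq_left (by linarith), max_eq_left (by linarith)]; ring
    rw [this]; ring
  refine ext_of_generate_finite _ (borel_eq_generateFrom_Ioi ℝ ▸ BorelSpace.measurable_eq)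
    isPiSystem_Ioi ?_ ?_
  · rintro _ ⟨x, rfl⟩
    exact h1 x
  -- As `t ≥ 0`, the half-line `Ioi (-1)` carries all the mass of both measures, so it gives the
  -- total masses.
  · have a1 := h1 (-1)
    rw [Measure.restrict_apply measurableSet_Ioi, inter_eq_self_of_subset_right
      (Ioi_subset_Ioi (by linarith))] at a1
    rw [Measure.restrict_apply MeasurableSet.univ, univ_inter, a1, Measure.smul_apply,
      Measure.smul_apply]
    congr 1
    rw [Measure.map_apply (by fun_prop) measurableSet_Ioi,
      Measure.map_apply (by fun_prop) MeasurableSet.univ, preimage_univ, measure_univ]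
    have : (fun y : ℝ => y + t) ⁻¹' Ioi (-1) = Ioi (-1 - t) := by ext; simp [sub_lt_iff_lt_add]
    rw [this, hp, max_eq_right (by linarith)]
    simp

lemma expMeasure_eq_withDensity (r : ℝ) :
    expMeasure r = (volume.restrict (Ioi 0)).withDensity
      (fun x => ENNReal.ofReal (r * Real.exp (-(r * x)))) := by
  have h : expMeasure r = volume.withDensity (exponentialPDF r) := rfl
  rw [h, restrict_Ioi_eq_restrict_Ici, ← withDensity_indicator measurableSet_Ici]
  congr 1
  ext x
  rw [exponentialPDF_eq, indicator_apply]
  simp only [mem_Ici]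
  split_ifs <;> simp

lemma integral_expMeasure {r : ℝ} (hr : 0 < r) (f : ℝ → ℝ) :
    ∫ x, f x ∂(expMeasure r) = ∫ x in Ioi 0, r * Real.exp (-(r * x)) * f x := by
  rw [expMeasure_eq_withDensity, integral_withDensity_eq_integral_toReal_smul (by fun_prop)
    (ae_of_all _ fun x => ENNReal.ofReal_lt_top)]
  refine integral_congr_ae (ae_of_all _ fun x => ?_)
  simp only [smul_eq_mul]
  rw [ENNReal.toReal_ofReal (by positivity)]

lemma integrable_expMeasure_iff {r : ℝ} (hr : 0 < r) (f : ℝ → ℝ) :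
    Integrable f (expMeasure r) ↔
      IntegrableOn (fun x => r * Real.exp (-(r * x)) * f x) (Ioi 0) := by
  rw [expMeasure_eq_withDensity, integrable_withDensity_iff_integrable_smul' (by fun_prop)
    (ae_of_all _ fun x => ENNReal.ofReal_lt_top), IntegrableOn]
  refine integrable_congr (ae_of_all _ fun x => ?_)
  simp only [smul_eq_mul]
  rw [ENNReal.toReal_ofReal (by positivity)]

lemma integrable_id_expMeasure {r : ℝ} (hr : 0 < r) :
    Integrable (fun x => x) (expMeasure r) := by
  rw [integrable_expMeasure_iff hr]
  have := integrableOn_rpow_mul_exp_neg_mul_rpow (p := 1) (s := 1) (by norm_num) one_pos hr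
  refine (this.const_mul r).congr ?_
  filter_upwards with x
  simp; ring

lemma integral_id_expMeasure {r : ℝ} (hr : 0 < r) : ∫ x, x ∂(expMeasure r) = 1 / r := by
  rw [integral_expMeasure hr]
  have := Real.integral_rpow_mul_exp_neg_mul_Ioi (a := 2) (r := r) (by norm_num) hr
  have h2 : ∀ x, r * Real.exp (-(r * x)) * x
      = r * (x ^ ((2:ℝ) - 1) * Real.exp (-(r * x))) := by
    intro x
    norm_num
    ring
  simp_rw [h2]
  rw [integral_const_mul, this]
  norm_num
  field_simp

lemma integral_exp_neg_expMeasure {r θ : ℝ} (hr : 0 < r) (hθ : 0 ≤ θ) :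
    ∫ x, Real.exp (-(θ * x)) ∂(expMeasure r) = r / (r + θ) := by
  rw [integral_expMeasure hr]
  have h2 : ∀ x, r * Real.exp (-(r * x)) * Real.exp (-(θ * x))
      = r * Real.exp ((-(r + θ)) * x) := by
    intro x
    rw [mul_assoc, ← Real.exp_add]; ring_nf
  simp_rw [h2]
  rw [integral_const_mul, integral_exp_mul_Ioi (by linarith)]
  have : r + θ ≠ 0 := by positivity
  have h3 : -(r + θ) ≠ 0 := neg_ne_zero.2 this
  simp only [mul_zero, Real.exp_zero]
  field_simp

/-- By memorylessness, the excess over `t` is again exponential of rate `r`, on an event of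
probability `exp (-(r * t))`. -/
lemma integral_sub_pos_expMeasure {r : ℝ} (hr : 0 < r) {t : ℝ} (ht : 0 ≤ t) :
    ∫ x, max (x - t) 0 ∂(expMeasure r) = Real.exp (-(r * t)) / r := by
  have h1 : ∫ x, max (x - t) 0 ∂(expMeasure r) = ∫ x in Ioi t, (x - t) ∂(expMeasure r) := by
    rw [← integral_indicator measurableSet_Ioi]
    refine integral_congr_ae (ae_of_all _ fun x => ?_)
    simp only [indicator_apply, mem_Ioi]
    split_ifs with h
    · exact max_eq_left (by linarith)
    · exact max_eq_right (by linarith)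
  rw [h1, expMeasure_memoryless hr ht, integral_smul_measure,
    integral_map (by fun_prop) (by fun_prop)]
  simp only [add_sub_cancel_right]
  rw [integral_id_expMeasure hr, ENNReal.toReal_ofReal (Real.exp_nonneg _), smul_eq_mul]
  ring

/-! ### Infinite products of probability measures on sequences -/

section Sequences

variable {E F : Type*} [MeasurableSpace E] [MeasurableSpace F]
  (κ : Measure E) [IsProbabilityMeasure κ] (η : Measure F) [IsProbabilityMeasure η]

/-- The law of a sequence of independent random variables with law `κ`. -/
abbrev iidLaw (κ : Measure E) [IsProbabilityMeasure κ] : Measure (ℕ → E) :=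
  Measure.infinitePi fun _ => κ

/-- The sequence `x` without its first `n` terms. -/
def shiftSeq (n : ℕ) (x : ℕ → E) : ℕ → E := fun i => x (n + i)

omit [MeasurableSpace E] in
@[simp] lemma shiftSeq_apply (n : ℕ) (x : ℕ → E) (i : ℕ) : shiftSeq n x i = x (n + i) := rfl

lemma measurable_shiftSeq (n : ℕ) : Measurable (shiftSeq n : (ℕ → E) → ℕ → E) := by
  unfold shiftSeq; fun_prop

lemma measurePreserving_comp_injective {f : ℕ → ℕ} (hf : Function.Injective f) :
    MeasurePreserving (fun (x : ℕ → E) i => x (f i)) (iidLaw κ) (iidLaw κ) :=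
  ⟨by fun_prop, Measure.map_infinitePi_infinitePi_of_inj (P := fun _ : ℕ => κ) hf⟩

lemma measurePreserving_shiftSeq (n : ℕ) :
    MeasurePreserving (shiftSeq n) (iidLaw κ) (iidLaw κ) :=
  measurePreserving_comp_injective κ (add_right_injective n)

lemma iIndepFun_eval : iIndepFun (fun (i : ℕ) (x : ℕ → E) => x i) (iidLaw κ) :=
  iIndepFun_infinitePi (X := fun _ x => x) (fun _ => measurable_id)

lemma measurePreserving_eval_iid (i : ℕ) :
    MeasurePreserving (fun x : ℕ → E => x i) (iidLaw κ) κ :=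
  measurePreserving_eval_infinitePi (fun _ : ℕ => κ) i

lemma measurableSet_box {t : ℕ → Set E} (ht : ∀ i, MeasurableSet (t i)) (n : ℕ) :
    MeasurableSet {x : ℕ → E | ∀ i < n, x i ∈ t i} := by
  have : {x : ℕ → E | ∀ i < n, x i ∈ t i} = ⋂ i, ⋂ (_ : i < n), (fun x => x i) ⁻¹' t i := by
    ext; simp
  rw [this]
  exact .iInter fun i => .iInter fun _ => measurable_pi_apply i (ht i)

/-- Finitely many coordinates lie in an initial segment, and the missing ones can be filled with
`univ`. Boxes on initial segments are the form suited to induction on the first term. -/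
lemma iidLaw_eq_of_boxes {m : Measure (ℕ → E)}
    (h : ∀ n (t : ℕ → Set E), (∀ i, MeasurableSet (t i)) →
      m {x | ∀ i < n, x i ∈ t i} = ∏ i ∈ Finset.range n, κ (t i)) : m = iidLaw κ := by
  classical
  refine Measure.eq_infinitePi _ fun s t ht => ?_
  obtain ⟨n, hn⟩ : ∃ n, ∀ i ∈ s, i < n :=
    ⟨s.sup id + 1, fun i hi => Nat.lt_succ_of_le (Finset.le_sup (f := id) hi)⟩
  have h1 := h n (fun i => if i ∈ s then t i else univ) (fun i => by
    by_cases hi : i ∈ s <;> simp [hi, ht i])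
  have h2 : {x : ℕ → E | ∀ i < n, x i ∈ (if i ∈ s then t i else univ)} = (s : Set ℕ).pi t := by
    ext x
    simp only [mem_ofPred_eq, Set.mem_pi, Finset.mem_coe]
    constructor
    · intro hx i hi
      simpa [hi] using hx i (hn i hi)
    · intro hx i _
      split_ifs with hi
      exacts [hx i hi, mem_univ _]
  rw [← h2, h1, ← Finset.prod_subset (s₁ := s) (fun i hi => Finset.mem_range.2 (hn i hi))]
  · exact Finset.prod_congr rfl fun i hi => by simp [hi]
  · intro i _ hi
    simp [hi]

/-- The first term and the other terms of a sequence. -/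
def headTail (x : ℕ → E) : E × (ℕ → E) := (x 0, shiftSeq 1 x)

lemma measurePreserving_headTail :
    MeasurePreserving headTail (iidLaw κ) (κ.prod (iidLaw κ)) := by
  have hm : Measurable (headTail (E := E)) := (measurable_pi_apply 0).prodMk (measurable_shiftSeq 1)
  refine ⟨hm, ?_⟩
  have hi : IndepFun (fun x : ℕ → E => x 0) (shiftSeq 1) (iidLaw κ) := by
    refine IndepFun.indepFun_process (𝓨 := fun _ : ℕ => E) (Y := fun i (x : ℕ → E) => x (1 + i))
      (measurable_pi_apply 0) (fun i => measurable_pi_apply _) fun I => ?_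
    have h := (iIndepFun_eval κ).indepFun_finset {0} (I.map (addLeftEmbedding 1))
      (by simp) (fun i => measurable_pi_apply i)
    exact h.comp (φ := fun z : ({0} : Finset ℕ) → E => z ⟨0, by simp⟩)
      (ψ := fun (z : (I.map (addLeftEmbedding 1) : Finset ℕ) → E) (i : I) => z ⟨1 + i, by simp⟩)
      (by fun_prop) (by fun_prop)
  rw [indepFun_iff_map_prod_eq_prod_map_map (measurable_pi_apply 0).aemeasurable
    (measurable_shiftSeq 1).aemeasurable] at hi
  rw [(measurePreserving_eval_iid κ 0).map_eq, (measurePreserving_shiftSeq κ 1).map_eq] at hi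
  exact hi

/-- The sequence of pairs made of two sequences. -/
def zipSeq (p : (ℕ → E) × (ℕ → F)) : ℕ → E × F := fun i => (p.1 i, p.2 i)

lemma measurePreserving_prodProdProdComm {α β γ δ : Type*} [MeasurableSpace α]
    [MeasurableSpace β] [MeasurableSpace γ] [MeasurableSpace δ] (a : Measure α) (b : Measure β)
    (c : Measure γ) (e : Measure δ) [SFinite a] [SFinite b] [SFinite c] [SFinite e] :
    MeasurePreserving (fun p : (α × β) × (γ × δ) => ((p.1.1, p.2.1), (p.1.2, p.2.2)))
      ((a.prod b).prod (c.prod e)) ((a.prod c).prod (b.prod e)) := by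
  have h1 := measurePreserving_prodAssoc a b (c.prod e)
  have h2 := (MeasurePreserving.id a).prod (measurePreserving_prodAssoc b c e).symm
  have h3 := (MeasurePreserving.id a).prod
    ((Measure.measurePreserving_swap (μ := b) (ν := c)).prod (MeasurePreserving.id e))
  have h4 := (MeasurePreserving.id a).prod (measurePreserving_prodAssoc c b e)
  have h5 := (measurePreserving_prodAssoc a c (b.prod e)).symm
  exact h5.comp (h4.comp (h3.comp (h2.comp h1)))

lemma measurePreserving_zipSeq :
    MeasurePreserving zipSeq ((iidLaw κ).prod (iidLaw η)) (iidLaw (κ.prod η)) := by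
  have hm : Measurable (zipSeq (E := E) (F := F)) := by unfold zipSeq; fun_prop
  have hs : MeasurePreserving (fun p : (ℕ → E) × (ℕ → F) =>
      ((p.1 0, p.2 0), (shiftSeq 1 p.1, shiftSeq 1 p.2))) ((iidLaw κ).prod (iidLaw η))
      ((κ.prod η).prod ((iidLaw κ).prod (iidLaw η))) :=
    (measurePreserving_prodProdProdComm _ _ _ _).comp
      ((measurePreserving_headTail κ).prod (measurePreserving_headTail η))
  refine ⟨hm, iidLaw_eq_of_boxes _ fun n => ?_⟩
  induction n with
  | zero => intro t ht; rw [Measure.map_apply hm (measurableSet_box ht 0)]; simp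
  | succ n ih =>
    intro t ht
    have h1 : zipSeq ⁻¹' {x : ℕ → E × F | ∀ i < n + 1, x i ∈ t i}
        = (fun p : (ℕ → E) × (ℕ → F) => ((p.1 0, p.2 0), (shiftSeq 1 p.1, shiftSeq 1 p.2))) ⁻¹'
          (t 0 ×ˢ (zipSeq ⁻¹' {x : ℕ → E × F | ∀ i < n, x i ∈ t (i + 1)})) := by
      ext p
      simp only [mem_preimage, mem_ofPred_eq, Set.mem_prod, zipSeq, shiftSeq_apply]
      constructor
      · intro h
        exact ⟨h 0 n.succ_pos, fun i hi => by rw [add_comm 1 i]; exact h _ (by omega)⟩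
      · rintro ⟨h0, h⟩ i hi
        cases i with
        | zero => exact h0
        | succ i => have := h i (by omega); rwa [add_comm 1 i] at this
    have hB := measurableSet_box (fun i => ht (i + 1)) n
    rw [Measure.map_apply hm (measurableSet_box ht _), h1, hs.measure_preimage
      ((ht 0).prod (hm hB)).nullMeasurableSet, Measure.prod_prod, ← Measure.map_apply hm hB,
      ih _ (fun i => ht _), Finset.prod_range_succ', mul_comm]

end Sequences

/-! ### Strong law for functions of the terms of an independent sequence -/

lemma ae_tendsto_average_eval {E : Type*} [MeasurableSpace E] (κ : Measure E)
    [IsProbabilityMeasure κ] {f : E → ℝ} (hf : Measurable f) (hi : Integrable f κ) :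
    ∀ᵐ x ∂(iidLaw κ), Tendsto (fun n : ℕ => (∑ i ∈ Finset.range n, f (x i)) / n) atTop
      (𝓝 (∫ e, f e ∂κ)) := by
  have h0 : ∫ x, f (x 0) ∂(iidLaw κ) = ∫ e, f e ∂κ := by
    have h := integral_map (μ := iidLaw κ) (φ := fun x => x 0)
      (measurable_pi_apply 0).aemeasurable (f := f) hf.aestronglyMeasurable
    rw [(measurePreserving_eval_iid κ 0).map_eq] at h
    exact h.symm
  rw [← h0]
  refine strong_law_ae_real (fun i (x : ℕ → E) => f (x i))
    ((measurePreserving_eval_iid κ 0).integrable_comp_of_integrable hi) ?_ ?_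
  · intro i j hij
    exact ((iIndepFun_eval κ).indepFun hij).comp hf hf
  · intro i
    refine IdentDistrib.comp ⟨(measurable_pi_apply i).aemeasurable,
      (measurable_pi_apply 0).aemeasurable, ?_⟩ hf
    exact (measurePreserving_eval_iid κ i).map_eq.trans (measurePreserving_eval_iid κ 0).map_eq.symm

lemma tendsto_atTop_of_average {u : ℕ → ℝ} {m : ℝ} (hm : 0 < m)
    (h : Tendsto (fun n : ℕ => u n / n) atTop (𝓝 m)) : Tendsto u atTop atTop := by
  have h1 : Tendsto (fun n : ℕ => u n / n * n) atTop atTop :=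
    h.pos_mul_atTop hm tendsto_natCast_atTop_atTop
  refine h1.congr' ?_
  filter_upwards [eventually_gt_atTop 0] with n hn
  field_simp

lemma ae_tendsto_sum_atTop {r : ℝ} (hr : 0 < r) [IsProbabilityMeasure (expMeasure r)] :
    ∀ᵐ x ∂(iidLaw (expMeasure r)), Tendsto (fun n => ∑ i ∈ Finset.range n, x i) atTop atTop := by
  filter_upwards [ae_tendsto_average_eval (expMeasure r) measurable_id
    (integrable_id_expMeasure hr)] with x hx
  refine tendsto_atTop_of_average (m := 1 / r) (by positivity) ?_
  rw [← integral_id_expMeasure hr]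
  exact hx

/-! ### The output theorem for one step of the queue -/

/-- Given that both variables exceed `t`, memorylessness lets one subtract `t` from both, which
leaves their difference unchanged. So the minimum is independent of the difference. -/
lemma min_sub_expMeasure {p q : ℝ} (hp : 0 < p) (hq : 0 < q) :
    ((expMeasure p).prod (expMeasure q)).map (fun z => (min z.1 z.2, z.1 - z.2)) =
      (expMeasure (p + q)).prod
        (((expMeasure p).prod (expMeasure q)).map (fun z => z.1 - z.2)) := by
  have := isProbabilityMeasure_expMeasure hp
  have := isProbabilityMeasure_expMeasure hq
  have hpq : 0 < p + q := by positivity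
  have := isProbabilityMeasure_expMeasure hpq
  have hm : Measurable (fun z : ℝ × ℝ => (min z.1 z.2, z.1 - z.2)) := by fun_prop
  have hd : Measurable (fun z : ℝ × ℝ => z.1 - z.2) := by fun_prop
  have : IsProbabilityMeasure (((expMeasure p).prod (expMeasure q)).map (fun z => z.1 - z.2)) :=
    Measure.isProbabilityMeasure_map hd.aemeasurable
  have key : ∀ t, 0 ≤ t → ∀ E, MeasurableSet E →
      ((expMeasure p).prod (expMeasure q)) {z | t < min z.1 z.2 ∧ z.1 - z.2 ∈ E} =
        expMeasure (p + q) (Ioi t) *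
          ((expMeasure p).prod (expMeasure q)) {z | z.1 - z.2 ∈ E} := by
    intro t ht E hE
    have h1 : {z : ℝ × ℝ | t < min z.1 z.2 ∧ z.1 - z.2 ∈ E}
        = {z | z.1 - z.2 ∈ E} ∩ (Ioi t ×ˢ Ioi t) := by
      ext z; simp [and_comm]
    have hE' : MeasurableSet {z : ℝ × ℝ | z.1 - z.2 ∈ E} := hd hE
    rw [h1, ← Measure.restrict_apply hE', ← Measure.prod_restrict, expMeasure_memoryless hp ht,
      expMeasure_memoryless hq ht, Measure.prod_smul_left, Measure.prod_smul_right,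
      Measure.map_prod_map _ _ (by fun_prop) (by fun_prop), expMeasure_Ioi hpq ht,
      Measure.smul_apply, Measure.smul_apply, Measure.map_apply (by fun_prop) hE', smul_eq_mul,
      smul_eq_mul, ← mul_assoc, ← ENNReal.ofReal_mul (Real.exp_nonneg _), ← Real.exp_add]
    congr 2
    · congr 2; ring
    · ext z; simp
  have hpos : ∀ᵐ z ∂((expMeasure p).prod (expMeasure q)), 0 < min z.1 z.2 := by
    have a := (Measure.quasiMeasurePreserving_fst (μ := expMeasure p) (ν := expMeasure q)).ae
      (expMeasure_ae_pos hp)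
    have b := (Measure.quasiMeasurePreserving_snd (μ := expMeasure p) (ν := expMeasure q)).ae
      (expMeasure_ae_pos hq)
    filter_upwards [a, b] with z h1 h2 using lt_min h1 h2
  symm
  have hS : (expMeasure (p + q)).FiniteSpanningSetsIn (range Ioi) :=
    { set := fun n => Ioi (-(n : ℝ))
      set_mem := fun n => ⟨_, rfl⟩
      finite := fun n => measure_lt_top _ _
      spanning := by
        refine eq_univ_of_forall fun x => mem_iUnion.2 ?_
        obtain ⟨n, hn⟩ := exists_nat_gt (-x)
        exact ⟨n, by simp only [mem_Ioi]; linarith⟩ }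
  refine Measure.prod_eq_generateFrom
    ((borel_eq_generateFrom_Ioi ℝ).symm.trans (BorelSpace.measurable_eq (α := ℝ)).symm)
    MeasurableSpace.generateFrom_measurableSet isPiSystem_Ioi MeasurableSpace.isPiSystem_measurableSet hS
    (Measure.toFiniteSpanningSetsIn _) ?_
  rintro _ ⟨t, rfl⟩ E hE
  have hE : MeasurableSet E := hE
  rw [Measure.map_apply hm (measurableSet_Ioi.prod hE), Measure.map_apply hd hE]
  have h2 : expMeasure (p + q) (Ioi t) = expMeasure (p + q) (Ioi (max t 0)) := by
    refine measure_congr ?_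
    filter_upwards [expMeasure_ae_pos hpq] with x hx
    exact propext ⟨fun h => max_lt h hx, fun h => (max_lt_iff.1 h).1⟩
  rw [h2]
  refine Eq.trans (measure_congr ?_) (key (max t 0) (le_max_right _ _) E hE)
  filter_upwards [hpos] with z hz
  exact propext ⟨fun h => ⟨max_lt h.1 hz, h.2⟩, fun h => ⟨(max_lt_iff.1 h.1).1, h.2⟩⟩

/-- With sojourn time `w`, arrival gap `a` and service `s`, the gap between departures and the
next sojourn time are independent of each other. -/
lemma measurePreserving_burke {β : ℝ} (hβ : 1 < β) :
    MeasurePreserving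
      (fun z : ℝ × (ℝ × ℝ) => (z.2.2 + max (z.2.1 - z.1) 0, max (z.1 - z.2.1) 0 + z.2.2))
      ((expMeasure (β - 1)).prod ((expMeasure 1).prod (expMeasure β)))
      ((expMeasure 1).prod (expMeasure (β - 1))) := by
  have hθ : 0 < β - 1 := by linarith
  have := isProbabilityMeasure_expMeasure hθ
  have := isProbabilityMeasure_expMeasure one_pos
  have := isProbabilityMeasure_expMeasure (r := β) (by linarith)
  have hms := min_sub_expMeasure hθ one_pos
  rw [sub_add_cancel] at hms
  set D := ((expMeasure (β - 1)).prod (expMeasure 1)).map (fun z => z.1 - z.2) with hD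
  have hd : MeasurePreserving (fun z : ℝ × ℝ => z.1 - z.2)
    ((expMeasure (β - 1)).prod (expMeasure 1)) D := ⟨by fun_prop, rfl⟩
  have : IsProbabilityMeasure D := Measure.isProbabilityMeasure_map (by fun_prop)
  have h1 : MeasurePreserving (fun z : ℝ × (ℝ × ℝ) => (z.2.2, z.1 - z.2.1))
      ((expMeasure (β - 1)).prod ((expMeasure 1).prod (expMeasure β)))
      ((expMeasure β).prod D) :=
    (Measure.measurePreserving_swap.comp (hd.prod (MeasurePreserving.id (expMeasure β)))).comp
      (measurePreserving_prodAssoc (expMeasure (β - 1)) (expMeasure 1) (expMeasure β)).symm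
  have h2 : MeasurePreserving (fun z : ℝ × ℝ => (min z.1 z.2, z.1 - z.2))
      ((expMeasure (β - 1)).prod (expMeasure 1)) ((expMeasure β).prod D) := ⟨by fun_prop, hms⟩
  -- With sojourn `W`, gap `A` and service `S`, the pairs `(S, W - A)` and `(min W A, W - A)` have
  -- the same law. Replacing `S` by `min W A` turns the departure gap into `A` and the next sojourn
  -- time into `W`, which are independent with the required laws.
  have h3 : MeasurePreserving (fun z : ℝ × ℝ => (z.1 + max (-z.2) 0, max z.2 0 + z.1))
      ((expMeasure β).prod D) ((expMeasure 1).prod (expMeasure (β - 1))) := by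
    refine ⟨by fun_prop, ?_⟩
    rw [← h2.map_eq, Measure.map_map (by fun_prop) (by fun_prop)]
    have : ((fun z : ℝ × ℝ => (z.1 + max (-z.2) 0, max z.2 0 + z.1)) ∘
        fun z : ℝ × ℝ => (min z.1 z.2, z.1 - z.2)) = Prod.swap := by
      ext z
      · simp only [Function.comp, Prod.fst_swap]
        rcases le_total z.1 z.2 with h | h
        · rw [min_eq_left h, max_eq_left (by linarith)]; ring
        · rw [min_eq_right h, max_eq_right (by linarith)]; ring
      · simp only [Function.comp, Prod.snd_swap]
        rcases le_total z.1 z.2 with h | h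
        · rw [min_eq_left h, max_eq_right (by linarith)]; ring
        · rw [min_eq_right h, max_eq_left (by linarith)]; ring
    rw [this]
    exact Measure.prod_swap
  have h4 := h3.comp h1
  convert h4 using 2 with z
  simp only [Function.comp, neg_sub]

/-! ### Independent sequences drawn successively from a random source -/

section Draw

variable {Z R Y : Type*} [MeasurableSpace Z] [MeasurableSpace R] [MeasurableSpace Y]

/-- From a parameter `z` and a source `r`, draw a value and a new source by `Φ`, and update the
parameter by `U`. -/
def drawStep (Φ : Z → R → Y × R) (U : Z → Y → Z) (p : Z × R) : Z × R :=
  (U p.1 (Φ p.1 p.2).1, (Φ p.1 p.2).2)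

/-- The `i`-th value drawn. -/
def draw (Φ : Z → R → Y × R) (U : Z → Y → Z) (p : Z × R) (i : ℕ) : Y :=
  (Φ ((drawStep Φ U)^[i] p).1 ((drawStep Φ U)^[i] p).2).1

variable {Φ : Z → R → Y × R} {U : Z → Y → Z}

lemma measurable_drawStep (hΦ : Measurable (Function.uncurry Φ))
    (hU : Measurable (Function.uncurry U)) : Measurable (drawStep Φ U) := by
  have h1 : Measurable (fun p : Z × R => Φ p.1 p.2) := hΦ
  exact (hU.comp (measurable_fst.prodMk h1.fst)).prodMk h1.snd

lemma measurable_draw (hΦ : Measurable (Function.uncurry Φ))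
    (hU : Measurable (Function.uncurry U)) : Measurable (draw Φ U) := by
  refine measurable_pi_lambda _ fun i => ?_
  exact (hΦ.comp ((measurable_drawStep hΦ hU).iterate i)).fst

/-- Each draw yields a `κ`-variable independent of a fresh source of law `ν`, for every value of the
parameter; so the parameter may depend on the past without disturbing independence. The induction
must hold for all `z`, because the parameter changes after the first draw. -/
lemma measurePreserving_draw {ν : Measure R} {κ : Measure Y} [IsProbabilityMeasure ν]
    [IsProbabilityMeasure κ] (hΦ : Measurable (Function.uncurry Φ))
    (hU : Measurable (Function.uncurry U))
    (h : ∀ z, MeasurePreserving (Φ z) ν (κ.prod ν)) (z : Z) :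
    MeasurePreserving (fun r => draw Φ U (z, r)) ν (iidLaw κ) := by
  have hm : ∀ z, Measurable (fun r => draw Φ U (z, r)) := fun z =>
    (measurable_draw hΦ hU).comp (by fun_prop)
  have hbox : ∀ n z (t : ℕ → Set Y), (∀ i, MeasurableSet (t i)) →
      ν {r | ∀ i < n, draw Φ U (z, r) i ∈ t i} = ∏ i ∈ Finset.range n, κ (t i) := by
    intro n
    induction n with
    | zero => intro z t ht; simp
    | succ n ih =>
      intro z t ht
      set B : Set (Y × R) := {p | p.1 ∈ t 0 ∧ ∀ i < n, draw Φ U (U z p.1, p.2) i ∈ t (i + 1)}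
      have h1 : {r | ∀ i < n + 1, draw Φ U (z, r) i ∈ t i} = Φ z ⁻¹' B := by
        ext r
        constructor
        · intro hr
          exact ⟨hr 0 n.succ_pos, fun i hi => hr (i + 1) (by omega)⟩
        · rintro ⟨h0, h1⟩ i hi
          cases i with
          | zero => exact h0
          | succ i => exact h1 i (by omega)
      have hB : MeasurableSet B := by
        have hd : Measurable (fun p : Y × R => draw Φ U (U z p.1, p.2)) :=
          (measurable_draw hΦ hU).comp
            ((hU.comp (measurable_const.prodMk measurable_fst)).prodMk measurable_snd)
        exact (measurable_fst (ht 0)).inter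
          (hd (measurableSet_box (fun i => ht (i + 1)) n))
      rw [h1, (h z).measure_preimage hB.nullMeasurableSet, Measure.prod_apply hB]
      have h2 : ∀ y, ν (Prod.mk y ⁻¹' B)
          = (t 0).indicator (fun _ => ∏ i ∈ Finset.range n, κ (t (i + 1))) y := by
        intro y
        by_cases hy : y ∈ t 0
        · rw [indicator_of_mem hy, ← ih (U z y) _ (fun i => ht (i + 1))]
          congr 1
          ext r
          simp [B, hy]
        · rw [indicator_of_notMem hy]
          have : Prod.mk y ⁻¹' B = ∅ := by ext r; simp [B, hy]
          rw [this, measure_empty]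
      simp_rw [h2]
      rw [lintegral_indicator_const (ht 0), Finset.prod_range_succ']
  refine ⟨hm z, iidLaw_eq_of_boxes _ fun n t ht => ?_⟩
  rw [Measure.map_apply (hm z) (measurableSet_box ht n)]
  exact hbox n z t ht

end Draw

/-! ### Restarting a Poisson process -/

/-- The index of the first event after time `t`. -/
def firstAfter (t : ℝ) (r : ℕ → ℝ) : ℕ := sInf {j | t < eventTime r j}

/-- The point process after time `t`: the time from `t` to the next event, and the gaps that
follow this event. -/
def restart (t : ℝ) (r : ℕ → ℝ) : ℝ × (ℕ → ℝ) :=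
  (eventTime r (firstAfter t r) - t, shiftSeq (firstAfter t r + 1) r)

lemma measurable_eventTime (j : ℕ) : Measurable (fun r : ℕ → ℝ => eventTime r j) := by
  unfold eventTime; fun_prop

lemma eventTime_succ' (r : ℕ → ℝ) (j : ℕ) :
    eventTime r (j + 1) = r 0 + eventTime (shiftSeq 1 r) j := by
  simp only [eventTime, shiftSeq_apply]
  rw [Finset.sum_range_succ', add_comm]
  simp_rw [add_comm 1]

lemma firstAfter_eq_iff {t : ℝ} {r : ℕ → ℝ} {j : ℕ} (h : t < eventTime r j)
    (h' : ∀ i < j, eventTime r i ≤ t) : firstAfter t r = j := by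
  refine le_antisymm (Nat.sInf_le h) (le_csInf ⟨j, h⟩ fun i hi => ?_)
  by_contra hc
  exact absurd (h' i (not_le.1 hc)) (not_le.2 hi)

lemma measurableSet_forall_lt {α : Type*} [MeasurableSpace α] {p : ℕ → α → Prop}
    (h : ∀ i, MeasurableSet {x | p i x}) (n : ℕ) : MeasurableSet {x | ∀ i < n, p i x} := by
  have : {x | ∀ i < n, p i x} = ⋂ i, ⋂ (_ : i < n), {x | p i x} := by ext; simp
  exact this ▸ .iInter fun i => .iInter fun _ => h i

lemma measurable_firstAfter : Measurable (fun p : ℝ × (ℕ → ℝ) => firstAfter p.1 p.2) := by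
  classical
  have hm : ∀ j, MeasurableSet {p : ℝ × (ℕ → ℝ) | p.1 < eventTime p.2 j} := fun j =>
    measurableSet_lt measurable_fst ((measurable_eventTime j).comp measurable_snd)
  -- The second alternative records the default `sInf ∅ = 0`, taken when no event follows the given
  -- time.
  have h : ∀ p : ℝ × (ℕ → ℝ), ∃ j, (p.1 < eventTime p.2 j ∧ ∀ i < j, eventTime p.2 i ≤ p.1) ∨
      (j = 0 ∧ ∀ i, eventTime p.2 i ≤ p.1) := by
    intro p
    by_cases hp : ∃ j, p.1 < eventTime p.2 j
    · exact ⟨Nat.find hp, Or.inl ⟨Nat.find_spec hp, fun i hi => not_lt.1 (Nat.find_min hp hi)⟩⟩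
    · exact ⟨0, Or.inr ⟨rfl, fun i => not_lt.1 fun h => hp ⟨i, h⟩⟩⟩
  have h2 : (fun p : ℝ × (ℕ → ℝ) => firstAfter p.1 p.2) = fun p => Nat.find (h p) := by
    ext p
    rcases Nat.find_spec (h p) with ⟨h1, h2⟩ | ⟨h1, h2⟩
    · exact firstAfter_eq_iff h1 h2
    · rw [h1, firstAfter]
      have : {j | p.1 < eventTime p.2 j} = ∅ := by
        ext j; simpa using h2 j
      rw [this, Nat.sInf_empty]
  rw [h2]
  refine measurable_find h fun j => ?_
  have h3 : ∀ i, MeasurableSet {p : ℝ × (ℕ → ℝ) | eventTime p.2 i ≤ p.1} := fun i =>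
    measurableSet_le ((measurable_eventTime i).comp measurable_snd) measurable_fst
  refine MeasurableSet.union ((hm j).inter ?_) (MeasurableSet.inter (.const _) ?_)
  · exact measurableSet_forall_lt h3 j
  · have h4 : MeasurableSet (⋂ i, {p : ℝ × (ℕ → ℝ) | eventTime p.2 i ≤ p.1}) := .iInter h3
    have h5 : {p : ℝ × (ℕ → ℝ) | ∀ i, eventTime p.2 i ≤ p.1}
        = ⋂ i, {p | eventTime p.2 i ≤ p.1} := by ext; simp
    rw [← h5] at h4
    exact h4

lemma measurable_restart : Measurable (fun p : ℝ × (ℕ → ℝ) => restart p.1 p.2) := by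
  have h : Measurable (fun q : ℕ × (ℝ × (ℕ → ℝ)) =>
      ((eventTime q.2.2 q.1 - q.2.1, shiftSeq (q.1 + 1) q.2.2) : ℝ × (ℕ → ℝ))) := by
    refine measurable_from_prod_countable_right fun j => ?_
    exact (((measurable_eventTime j).comp measurable_snd).sub measurable_fst).prodMk
      ((measurable_shiftSeq (j + 1)).comp measurable_snd)
  exact h.comp (measurable_firstAfter.prodMk measurable_id)

/-- Split according to the index `j` of the first event after `t`. Conditionally on each `j`, the
restarted process has the claimed law: for `j = 0` this is memorylessness, and conditioning on the
first gap lowers both `j` and `t`. -/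
lemma measurePreserving_restart {l : ℝ} (hl : 0 < l) [IsProbabilityMeasure (expMeasure l)]
    {t : ℝ} (ht : 0 ≤ t) :
    MeasurePreserving (restart t) (iidLaw (expMeasure l))
      ((expMeasure l).prod (iidLaw (expMeasure l))) := by
  set ν := iidLaw (expMeasure l) with hν
  have hmr : Measurable (restart t) := by
    have := measurable_restart.comp (measurable_prodMk_left (x := t))
    exact this
  -- The event that `j` is the first index after `t` and that the restarted process lies in `B`.
  let G : ℕ → ℝ → Set (ℝ × (ℕ → ℝ)) → Set (ℕ → ℝ) := fun j t B =>
    {r | (∀ i < j, eventTime r i ≤ t) ∧ t < eventTime r j ∧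
      (eventTime r j - t, shiftSeq (j + 1) r) ∈ B}
  have hG2 : ∀ j (B : Set (ℝ × (ℕ → ℝ))), MeasurableSet B →
      MeasurableSet {p : ℝ × (ℕ → ℝ) | p.2 ∈ G j p.1 B} := by
    intro j B hB
    have h3 : ∀ i, Measurable (fun p : ℝ × (ℕ → ℝ) => eventTime p.2 i) := fun i =>
      (measurable_eventTime i).comp measurable_snd
    refine MeasurableSet.inter ?_ (MeasurableSet.inter ?_ ?_)
    · exact measurableSet_forall_lt (fun i => measurableSet_le (h3 i) measurable_fst) j
    · exact measurableSet_lt measurable_fst (h3 j)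
    · exact (((h3 j).sub measurable_fst).prodMk
        ((measurable_shiftSeq (j + 1)).comp measurable_snd)) hB
  have hG : ∀ j t (B : Set (ℝ × (ℕ → ℝ))), MeasurableSet B → MeasurableSet (G j t B) :=
    fun j t B hB => (measurable_prodMk_left (x := t)) (hG2 j B hB)
  have key : ∀ j t, 0 ≤ t → ∀ B, MeasurableSet B →
      ν (G j t B) = ν (G j t univ) * ((expMeasure l).prod ν) B := by
    intro j
    induction j with
    | zero =>
      intro t ht
      have h0 : ∀ B, MeasurableSet B →
          ν (G 0 t B) = ENNReal.ofReal (Real.exp (-(l * t))) * ((expMeasure l).prod ν) B := by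
        intro B hB
        set B' : Set (ℝ × (ℕ → ℝ)) := (fun p => (p.1 - t, p.2)) ⁻¹' B with hB'
        have hmB' : MeasurableSet B' := (by fun_prop : Measurable
          (fun p : ℝ × (ℕ → ℝ) => (p.1 - t, p.2))) hB
        have h1 : G 0 t B = headTail ⁻¹' (B' ∩ (Ioi t ×ˢ univ)) := by
          ext r
          simp [G, headTail, eventTime, B', and_comm]
        rw [h1, (measurePreserving_headTail _).measure_preimage
          (hmB'.inter (measurableSet_Ioi.prod .univ)).nullMeasurableSet,
          ← Measure.restrict_apply hmB', ← Measure.prod_restrict, Measure.restrict_univ,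
          expMeasure_memoryless hl ht, Measure.prod_smul_left, Measure.smul_apply, smul_eq_mul]
        congr 1
        have h2 : MeasurePreserving (fun p : ℝ × (ℕ → ℝ) => (p.1 + t, p.2))
            ((expMeasure l).prod ν) (((expMeasure l).map (· + t)).prod ν) :=
          MeasurePreserving.prod (f := (· + t)) (g := id) ⟨by fun_prop, rfl⟩
            (MeasurePreserving.id ν)
        rw [← h2.measure_preimage hmB'.nullMeasurableSet]
        congr 1
        ext p
        simp [B']
      intro B hB
      rw [h0 B hB, h0 univ .univ, measure_univ, mul_one]
    | succ j ih =>
      intro t ht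
      have h0 : ∀ B, MeasurableSet B →
          ν (G (j + 1) t B) = ∫⁻ x in Iic t, ν (G j (t - x) B) ∂(expMeasure l) := by
        intro B hB
        set C : Set (ℝ × (ℕ → ℝ)) := {p | p.1 ∈ Iic t ∧ p.2 ∈ G j (t - p.1) B} with hC
        have hmC : MeasurableSet C := (measurable_fst measurableSet_Iic).inter
          ((by fun_prop : Measurable (fun p : ℝ × (ℕ → ℝ) => (t - p.1, p.2))) (hG2 j B hB))
        have h1 : G (j + 1) t B = headTail ⁻¹' C := by
          ext r
          have e2 : shiftSeq (j + 1 + 1) r = shiftSeq (j + 1) (shiftSeq 1 r) := by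
            ext i; simp only [shiftSeq_apply]; congr 1; omega
          simp only [G, C, headTail, mem_preimage, mem_ofPred_eq, mem_Iic]
          rw [eventTime_succ', e2]
          have e3 : r 0 + eventTime (shiftSeq 1 r) j - t
            = eventTime (shiftSeq 1 r) j - (t - r 0) := by ring
          rw [e3]
          constructor
          · rintro ⟨a, b, c⟩
            refine ⟨by simpa [eventTime] using a 0 j.succ_pos, fun i hi => ?_, by linarith, c⟩
            have := a (i + 1) (by omega)
            rw [eventTime_succ'] at this
            linarith
          · rintro ⟨a, b, c, e⟩
            refine ⟨fun i hi => ?_, by linarith, e⟩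
            cases i with
            | zero => simpa [eventTime] using a
            | succ i =>
              rw [eventTime_succ']
              have := b i (by omega)
              linarith
        rw [h1, (measurePreserving_headTail _).measure_preimage hmC.nullMeasurableSet,
          Measure.prod_apply hmC, ← lintegral_indicator measurableSet_Iic]
        refine lintegral_congr fun x => ?_
        by_cases hx : x ∈ Iic t
        · rw [indicator_of_mem hx]
          congr 1
          ext r
          simp only [C, mem_preimage, mem_ofPred_eq, hx, true_and]
        · rw [indicator_of_notMem hx]
          have : Prod.mk x ⁻¹' C = ∅ := by
            ext r; simp only [C, mem_preimage, mem_ofPred_eq, hx, false_and, mem_empty_iff_false]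
          rw [this, measure_empty]
      intro B hB
      rw [h0 B hB, h0 univ .univ, ← lintegral_mul_const]
      · refine setLIntegral_congr_fun measurableSet_Iic fun x hx => ?_
        exact ih (t - x) (by have : x ≤ t := hx; linarith) B hB
      · exact (measurable_measure_prodMk_left (ν := ν) (hG2 j univ .univ)).comp
          (measurable_const.sub measurable_id)
  have hdisj : Pairwise (Function.onFun Disjoint fun j => G j t univ) := by
    intro i j hij
    refine Set.disjoint_left.2 fun r hi hj => hij ?_
    rw [← firstAfter_eq_iff hi.2.1 hi.1, firstAfter_eq_iff hj.2.1 hj.1]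
  have hae : ∀ᵐ r ∂ν, r ∈ ⋃ j, G j t univ := by
    filter_upwards [ae_tendsto_sum_atTop hl] with r hr
    have h1 : ∃ j, t < eventTime r j := by
      obtain ⟨n, hn⟩ := ((hr.comp (tendsto_add_atTop_nat 1)).eventually_gt_atTop t).exists
      exact ⟨n, hn⟩
    classical
    exact mem_iUnion.2 ⟨Nat.find h1, fun i hi => not_lt.1 (Nat.find_min h1 hi),
      Nat.find_spec h1, mem_univ _⟩
  have hsum : ∑' j, ν (G j t univ) = 1 := by
    rw [← measure_iUnion hdisj fun j => hG j t univ .univ]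
    exact (prob_compl_eq_zero_iff (.iUnion fun j => hG j t univ .univ)).1 hae
  refine ⟨hmr, Measure.ext fun B hB => ?_⟩
  rw [Measure.map_apply hmr hB]
  have h1 : (restart t ⁻¹' B : Set (ℕ → ℝ)) =ᵐ[ν] ⋃ j, G j t B := by
    filter_upwards [hae] with r hr
    obtain ⟨j, hj⟩ := mem_iUnion.1 hr
    have hf := firstAfter_eq_iff hj.2.1 hj.1
    refine propext ⟨fun h => mem_iUnion.2 ⟨j, hj.1, hj.2.1, ?_⟩, fun h => ?_⟩
    · have h : restart t r ∈ B := h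
      rwa [restart, hf] at h
    · obtain ⟨k, hk⟩ := mem_iUnion.1 h
      have hf := firstAfter_eq_iff hk.2.1 hk.1
      change restart t r ∈ B
      rw [restart, hf]
      exact hk.2.2
  rw [measure_congr h1, measure_iUnion _ fun j => hG j t B hB]
  · simp_rw [fun j => key j t ht B hB]
    rw [ENNReal.tsum_mul_right, hsum, one_mul]
  · intro i j hij
    have hle : ∀ j, G j t B ⊆ G j t univ := fun j r h => ⟨h.1, h.2.1, mem_univ _⟩
    exact (hdisj hij).mono (hle i) (hle j)

/-! ### Long-run averages -/

/-- A limit of averages survives an approximation whose accumulated error is at most `ε * n`; the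
first `r` terms are negligible. -/
lemma HasLongRunAverage.of_approx {u : ℕ → ℝ} {L : ℝ}
    (h : ∀ ε > 0, ∃ (r : ℕ) (b : ℕ → ℝ) (Lb : ℝ), |Lb - L| ≤ ε ∧ HasLongRunAverage b Lb ∧
      ∀ n : ℕ, |∑ i ∈ Finset.range n, (u (r + i) - b i)| ≤ ε * n) : HasLongRunAverage u L := by
  refine Metric.tendsto_nhds.2 fun ε hε => ?_
  -- There are four errors, each at most `ε / 8 * k`: the initial terms, the approximation, the
  -- average of `b` and the difference of the limits.
  obtain ⟨r, b, Lb, h1, h2, h3⟩ := h (ε / 8) (by positivity)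
  set C := |∑ i ∈ Finset.range r, u i| + |L| * r with hC
  have e1 := Metric.tendsto_nhds.1 h2 (ε / 8) (by positivity)
  have e2 : ∀ᶠ n : ℕ in atTop, C / (ε / 8) ≤ n := tendsto_natCast_atTop_atTop.eventually_ge_atTop _
  have e3 := (e1.and (e2.and (eventually_gt_atTop 0)))
  filter_upwards [(tendsto_sub_atTop_nat r).eventually e3, eventually_ge_atTop r] with n hn hr
  obtain ⟨k, rfl⟩ := Nat.exists_eq_add_of_le hr
  rw [Nat.add_sub_cancel_left] at hn
  obtain ⟨a1, a2, a3⟩ := hn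
  have hk : (0 : ℝ) < k := by exact_mod_cast a3
  rw [Real.dist_eq] at a1 ⊢
  have b1 : |∑ i ∈ Finset.range k, b i - Lb * k| ≤ ε / 8 * k := by
    have : ∑ i ∈ Finset.range k, b i - Lb * k = ((∑ i ∈ Finset.range k, b i) / k - Lb) * k := by
      field_simp
    rw [this, abs_mul, abs_of_pos hk]
    exact mul_le_mul_of_nonneg_right a1.le hk.le
  have b2 := h3 k
  rw [Finset.sum_sub_distrib] at b2
  have b3 : |Lb * k - L * k| ≤ ε / 8 * k := by
    rw [← sub_mul, abs_mul, abs_of_pos hk]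
    exact mul_le_mul_of_nonneg_right h1 hk.le
  have b4 : C ≤ ε / 8 * k := by
    rw [div_le_iff₀ (by positivity)] at a2; linarith
  have b5 : (0 : ℝ) < (r + k : ℕ) := by push_cast; positivity
  have b6 : (∑ i ∈ Finset.range (r + k), u i) / ((r + k : ℕ) : ℝ) - L
      = (∑ i ∈ Finset.range (r + k), u i - L * (r + k : ℕ)) / ((r + k : ℕ) : ℝ) := by
    field_simp
  rw [b6, abs_div, abs_of_pos b5, div_lt_iff₀ b5, Finset.sum_range_add]
  have b7 : |L * r| = |L| * r := by rw [abs_mul, Nat.abs_cast]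
  have b8 : (∑ x ∈ Finset.range r, u x + ∑ x ∈ Finset.range k, u (r + x)) - L * (r + k : ℕ)
      = ∑ x ∈ Finset.range r, u x - L * r
        + (∑ x ∈ Finset.range k, u (r + x) - ∑ x ∈ Finset.range k, b x)
        + (∑ i ∈ Finset.range k, b i - Lb * k) + (Lb * k - L * k) := by push_cast; ring
  rw [b8]
  refine (abs_add_le _ _).trans_lt ?_
  refine (add_le_add (abs_add_le _ _) le_rfl).trans_lt ?_
  refine (add_le_add (add_le_add (abs_add_le _ _) le_rfl) le_rfl).trans_lt ?_
  refine (add_le_add (add_le_add (add_le_add (abs_sub _ _) le_rfl) le_rfl) le_rfl).trans_lt ?_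
  rw [b7]
  push_cast
  have : 0 < ε * k := by positivity
  have : 0 ≤ ε * r := by positivity
  nlinarith

lemma HasLongRunAverage.of_shift {u : ℕ → ℝ} {L : ℝ} (r : ℕ)
    (h : HasLongRunAverage (fun i => u (r + i)) L) : HasLongRunAverage u L :=
  .of_approx fun ε hε => ⟨r, _, L, by simpa using hε.le, h, fun n => by simp; positivity⟩

lemma HasLongRunAverage.add {u v : ℕ → ℝ} {L M : ℝ} (hu : HasLongRunAverage u L)
    (hv : HasLongRunAverage v M) : HasLongRunAverage (fun i => u i + v i) (L + M) := by
  refine (Tendsto.add hu hv).congr fun n => ?_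
  rw [Finset.sum_add_distrib, add_div]

lemma HasLongRunAverage.of_eventually_shift_eq {u v : ℕ → ℝ} {L : ℝ} (r s : ℕ)
    (hv : HasLongRunAverage v L) (h : ∀ᶠ i in atTop, u (r + i) = v (s + i)) :
    HasLongRunAverage u L := by
  obtain ⟨N, hN⟩ := eventually_atTop.1 h
  have hv' : HasLongRunAverage (fun i => v (s + N + i)) L := by
    have h1 := (tendsto_add_atTop_iff_nat (s + N)).2 hv
    have h2 : Tendsto (fun n : ℕ => (∑ k ∈ Finset.range (s + N), v k) / (n : ℝ)) atTop (𝓝 0) :=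
      tendsto_const_nhds.div_atTop tendsto_natCast_atTop_atTop
    have h3 : Tendsto (fun n : ℕ => ((n + (s + N) : ℕ) : ℝ) / n) atTop (𝓝 1) := by
      have : Tendsto (fun n : ℕ => 1 + ((s + N : ℕ) : ℝ) / n) atTop (𝓝 (1 + 0)) :=
        tendsto_const_nhds.add (tendsto_const_nhds.div_atTop tendsto_natCast_atTop_atTop)
      rw [add_zero] at this
      refine this.congr' ?_
      filter_upwards [eventually_gt_atTop 0] with n hn
      have : (n : ℝ) ≠ 0 := by positivity
      push_cast
      field_simp
    have h4 := (h1.mul h3).sub h2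
    rw [mul_one, sub_zero] at h4
    refine h4.congr' ?_
    filter_upwards [eventually_gt_atTop 0] with n hn
    have : (n : ℝ) ≠ 0 := by positivity
    have h5 : ((n + (s + N) : ℕ) : ℝ) ≠ 0 := by positivity
    rw [div_mul_div_cancel₀ h5, add_comm n, Finset.sum_range_add]
    ring
  refine .of_shift (r + N) ?_
  convert hv' using 2 with i
  rw [add_assoc, add_assoc]
  exact hN (N + i) (by omega)

/-! ### The maximal ergodic inequality -/

section Maximal

variable {X : Type*} [MeasurableSpace X] {ν : Measure X} [IsProbabilityMeasure ν] {T : X → X}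

/-- The largest of the first `N + 1` Birkhoff sums of `f`. -/
def maxBirkhoff (T : X → X) (f : X → ℝ) : ℕ → X → ℝ
  | 0 => fun _ => 0
  | N + 1 => fun x => max 0 (f x + maxBirkhoff T f N (T x))

omit [MeasurableSpace X] in
lemma maxBirkhoff_nonneg (f : X → ℝ) (N : ℕ) (x : X) : 0 ≤ maxBirkhoff T f N x := by
  cases N
  exacts [le_rfl, le_max_left _ _]

omit [MeasurableSpace X] in
lemma maxBirkhoff_mono (f : X → ℝ) (N : ℕ) (x : X) :
    maxBirkhoff T f N x ≤ maxBirkhoff T f (N + 1) x := by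
  induction N generalizing x with
  | zero => exact maxBirkhoff_nonneg _ _ _
  | succ N ih =>
    rw [maxBirkhoff, maxBirkhoff]
    exact max_le_max le_rfl (add_le_add le_rfl (ih _))

omit [MeasurableSpace X] in
lemma sum_iterate_le_maxBirkhoff (f : X → ℝ) (N : ℕ) (x : X) :
    ∑ i ∈ Finset.range N, f (T^[i] x) ≤ maxBirkhoff T f N x := by
  induction N generalizing x with
  | zero => simp [maxBirkhoff]
  | succ N ih =>
    rw [Finset.sum_range_succ', maxBirkhoff, add_comm]
    exact (add_le_add le_rfl (ih _)).trans (le_max_right _ _)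

omit [IsProbabilityMeasure ν] in
lemma integrable_maxBirkhoff (hT : MeasurePreserving T ν ν) {f : X → ℝ} (hf : Integrable f ν)
    (N : ℕ) : Integrable (maxBirkhoff T f N) ν := by
  induction N with
  | zero => exact integrable_zero _ _ _
  | succ N ih =>
    exact (integrable_zero X ℝ ν).sup (hf.add (hT.integrable_comp_of_integrable ih))

lemma measurable_maxBirkhoff (hT : Measurable T) {f : X → ℝ} (hf : Measurable f)
    (N : ℕ) : Measurable (maxBirkhoff T f N) := by
  induction N with
  | zero => exact measurable_const
  | succ N ih => exact measurable_const.max (hf.add (ih.comp hT))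

-- Garsia's argument: where the maximum `M` is positive, `f ≥ M - M ∘ T`; elsewhere `M = 0 ≤ M ∘ T`.
-- Integrate and use the invariance of `ν`.
omit [IsProbabilityMeasure ν] in
lemma setIntegral_maxBirkhoff_nonneg (hT : MeasurePreserving T ν ν) {f : X → ℝ}
    (hfm : Measurable f) (hf : Integrable f ν) (N : ℕ) :
    0 ≤ ∫ x in {x | 0 < maxBirkhoff T f N x}, f x ∂ν := by
  cases N with
  | zero => simp [maxBirkhoff]
  | succ N =>
    set M := maxBirkhoff T f (N + 1) with hM
    have hMi : Integrable M ν := integrable_maxBirkhoff hT hf _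
    have hMm : Measurable M := measurable_maxBirkhoff hT.measurable hfm _
    have hA : MeasurableSet {x | 0 < M x} := measurableSet_lt measurable_const hMm
    have hMT : Integrable (fun x => M (T x)) ν := hT.integrable_comp_of_integrable hMi
    have h0 : ∫ x, M (T x) ∂ν = ∫ x, M x ∂ν := by
      have := integral_map hT.measurable.aemeasurable (f := M) (μ := ν)
        hMm.aestronglyMeasurable
      rw [hT.map_eq] at this
      exact this.symm
    have h1 : 0 ≤ ∫ x, ({x | 0 < M x}.indicator f x - (M x - M (T x))) ∂ν := by
      refine integral_nonneg fun x => ?_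
      simp only [indicator_apply, Pi.zero_apply, mem_ofPred_eq]
      split_ifs with h
      · have h2 : M x = f x + maxBirkhoff T f N (T x) := by
          rw [hM, maxBirkhoff] at h ⊢
          exact max_eq_right (by simpa using (lt_max_iff.1 h).resolve_left (lt_irrefl _) |>.le)
        have h3 := maxBirkhoff_mono (T := T) f N (T x)
        linarith
      · have h2 : M x = 0 := le_antisymm (not_lt.1 h) (maxBirkhoff_nonneg _ _ _)
        have h3 : 0 ≤ M (T x) := maxBirkhoff_nonneg _ _ _
        linarith
    have h2 : ∫ x, ({x | 0 < M x}.indicator f x - (M x - M (T x))) ∂ν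
        = ∫ x, {x | 0 < M x}.indicator f x ∂ν - (∫ x, M x ∂ν - ∫ x, M (T x) ∂ν) := by
      rw [integral_sub (hf.indicator hA) (g := fun x => M x - M (T x)) (hMi.sub hMT),
        integral_sub hMi hMT]
    rw [h2, h0, sub_self, sub_zero, integral_indicator hA] at h1
    exact h1

/-- The maximal inequality for `g - ε`, on the increasing union over `N`. -/
lemma measure_exists_lt_sum_iterate_le (hT : MeasurePreserving T ν ν) {g : X → ℝ}
    (hgm : Measurable g) (hg : Integrable g ν) (hg0 : 0 ≤ g) {ε : ℝ} (hε : 0 < ε) :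
    ν {x | ∃ n : ℕ, ε * n < ∑ i ∈ Finset.range n, g (T^[i] x)} ≤
      ENNReal.ofReal ((∫ x, g x ∂ν) / ε) := by
  set f : X → ℝ := fun x => g x - ε with hf
  have hfm : Measurable f := hgm.sub_const _
  have hfi : Integrable f ν := hg.sub (integrable_const ε)
  have h1 : {x | ∃ n : ℕ, ε * n < ∑ i ∈ Finset.range n, g (T^[i] x)}
      ⊆ ⋃ N, {x | 0 < maxBirkhoff T f N x} := by
    rintro x ⟨n, hn⟩
    refine mem_iUnion.2 ⟨n, ?_⟩
    have := sum_iterate_le_maxBirkhoff (T := T) f n x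
    rw [hf, Finset.sum_sub_distrib, Finset.sum_const, Finset.card_range, nsmul_eq_mul] at this
    change 0 < maxBirkhoff T f n x
    linarith
  refine (measure_mono h1).trans ?_
  have hmono : Monotone fun N => {x | 0 < maxBirkhoff T f N x} :=
    monotone_nat_of_le_succ fun N x hx => lt_of_lt_of_le hx (maxBirkhoff_mono f N x)
  rw [hmono.measure_iUnion]
  refine iSup_le fun N => ?_
  have hA : MeasurableSet {x | 0 < maxBirkhoff T f N x} :=
    measurableSet_lt measurable_const (measurable_maxBirkhoff hT.measurable hfm N)
  have h2 := setIntegral_maxBirkhoff_nonneg hT hfm hfi N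
  rw [hf, integral_sub hg.integrableOn (integrable_const ε).integrableOn, setIntegral_const,
    smul_eq_mul] at h2
  have h3 : ∫ x in {x | 0 < maxBirkhoff T f N x}, g x ∂ν ≤ ∫ x, g x ∂ν :=
    setIntegral_le_integral hg (ae_of_all _ hg0)
  rw [← ofReal_measureReal]
  refine ENNReal.ofReal_le_ofReal ((le_div_iff₀ hε).2 ?_)
  rw [hf] at h3
  linarith

/-- The event that the bound fails for all `r ≥ N` has probability at most `(∫ g r) / ε` for each
such `r`, hence 0. Countably many `ε` suffice. -/
lemma ae_forall_exists_sum_iterate_le (hT : MeasurePreserving T ν ν) {g : ℕ → X → ℝ}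
    (hgm : ∀ r, Measurable (g r)) (hg : ∀ r, Integrable (g r) ν) (hg0 : ∀ r, 0 ≤ g r)
    (hlim : Tendsto (fun r => ∫ x, g r x ∂ν) atTop (𝓝 0)) :
    ∀ᵐ x ∂ν, ∀ ε > 0, ∃ᶠ r in atTop, ∀ n : ℕ, ∑ i ∈ Finset.range n, g r (T^[i] x) ≤ ε * n := by
  have h1 : ∀ k : ℕ, ∀ᵐ x ∂ν, ∃ᶠ r in atTop, ∀ n : ℕ,
      ∑ i ∈ Finset.range n, g r (T^[i] x) ≤ (1 / ((k : ℝ) + 1)) * n := by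
    intro k
    have hε : (0 : ℝ) < 1 / ((k : ℝ) + 1) := by positivity
    have h2 : ∀ N : ℕ, ν {x | ∀ r ≥ N, ∃ n : ℕ,
        (1 / ((k : ℝ) + 1)) * n < ∑ i ∈ Finset.range n, g r (T^[i] x)} = 0 := by
      intro N
      have h3 : ∀ r ≥ N, ν {x | ∀ r ≥ N, ∃ n : ℕ,
          (1 / ((k : ℝ) + 1)) * n < ∑ i ∈ Finset.range n, g r (T^[i] x)} ≤
          ENNReal.ofReal ((∫ x, g r x ∂ν) / (1 / ((k : ℝ) + 1))) := fun r hr =>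
        (measure_mono (fun x (hx : ∀ r ≥ N, ∃ n : ℕ, _ < _) => hx r hr)).trans
          (measure_exists_lt_sum_iterate_le hT (hgm r) (hg r) (hg0 r) hε)
      have h4 : Tendsto (fun r => ENNReal.ofReal ((∫ x, g r x ∂ν) / (1 / ((k : ℝ) + 1)))) atTop
          (𝓝 0) := by
        have := ENNReal.tendsto_ofReal (hlim.div_const (1 / ((k : ℝ) + 1)))
        simpa using this
      exact le_antisymm (ge_of_tendsto h4 (eventually_atTop.2 ⟨N, h3⟩)) zero_le
    have h5 := ae_all_iff.2 fun N => measure_eq_zero_iff_ae_notMem.1 (h2 N)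
    filter_upwards [h5] with x hx
    refine frequently_atTop.2 fun N => ?_
    have : ¬ ∀ r ≥ N, ∃ n : ℕ,
        (1 / ((k : ℝ) + 1)) * n < ∑ i ∈ Finset.range n, g r (T^[i] x) := hx N
    push Not at this
    exact this
  filter_upwards [ae_all_iff.2 h1] with x hx ε hε
  obtain ⟨k, hk⟩ := exists_nat_one_div_lt hε
  exact (hx k).mono fun r hr n => (hr n).trans (mul_le_mul_of_nonneg_right hk.le n.cast_nonneg)

end Maximal

/-! ### Strong law for functions of finitely many consecutive terms -/

/-- Windows of length `m` starting at indices congruent modulo `m` are disjoint, so the usual strong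
law applies in each residue class; the classes are then averaged. -/
lemma ae_longRunAverage_shiftSeq {E : Type*} [MeasurableSpace E] [Inhabited E] (κ : Measure E)
    [IsProbabilityMeasure κ] {h : (ℕ → E) → ℝ} (hm : Measurable h) (hi : Integrable h (iidLaw κ))
    (h0 : 0 ≤ h) {m : ℕ} (hm0 : 0 < m) (hdep : ∀ x y, (∀ i < m, x i = y i) → h x = h y) :
    ∀ᵐ x ∂(iidLaw κ), HasLongRunAverage (fun i => h (shiftSeq i x)) (∫ x, h x ∂(iidLaw κ)) := by
  classical
  have hint : ∀ k, ∫ x, h (shiftSeq k x) ∂(iidLaw κ) = ∫ x, h x ∂(iidLaw κ) := fun k => by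
    have := integral_map (measurable_shiftSeq k).aemeasurable (f := h) (μ := iidLaw κ)
      hm.aestronglyMeasurable
    rw [(measurePreserving_shiftSeq κ k).map_eq] at this
    exact this.symm
  have hmk : ∀ k, Measurable fun x : ℕ → E => h (shiftSeq k x) := fun k =>
    hm.comp (measurable_shiftSeq k)
  have hind : ∀ k l, k + m ≤ l →
      IndepFun (fun x : ℕ → E => h (shiftSeq k x)) (fun x => h (shiftSeq l x)) (iidLaw κ) := by
    intro k l hkl
    -- Outside the window any default value will do, since `h` does not look there.
    let ext : ∀ k, ((Finset.Ico k (k + m) : Finset ℕ) → E) → (ℕ → E) := fun k z i =>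
      if hi : k + i ∈ Finset.Ico k (k + m) then z ⟨k + i, hi⟩ else default
    have hext : ∀ k, Measurable (ext k) := fun k => by
      refine measurable_pi_lambda _ fun i => ?_
      by_cases hi : k + i ∈ Finset.Ico k (k + m)
      · simp only [ext, hi, dite_true]; fun_prop
      · simp only [ext, hi, dite_false]; fun_prop
    have heq : ∀ k, (fun x : ℕ → E => h (shiftSeq k x)) = (fun z => h (ext k z)) ∘
        (fun x (i : (Finset.Ico k (k + m) : Finset ℕ)) => x i) := fun k => by
      funext x
      refine hdep _ _ fun i hi => ?_
      have : k + i ∈ Finset.Ico k (k + m) := by simp; omega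
      simp only [shiftSeq_apply, ext, this, dite_true]
    have hd : Disjoint (Finset.Ico k (k + m)) (Finset.Ico l (l + m)) := by
      refine Finset.disjoint_left.2 fun a ha hb => ?_
      simp only [Finset.mem_Ico] at ha hb
      omega
    rw [heq k, heq l]
    exact ((iIndepFun_eval κ).indepFun_finset _ _ hd fun i => measurable_pi_apply i).comp
      (hm.comp (hext k)) (hm.comp (hext l))
  have hres : ∀ ρ : ℕ, ∀ᵐ x ∂(iidLaw κ), Tendsto (fun n : ℕ =>
      (∑ j ∈ Finset.range n, h (shiftSeq (j * m + ρ) x)) / n) atTop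
      (𝓝 (∫ x, h x ∂(iidLaw κ))) := by
    intro ρ
    have := strong_law_ae_real (μ := iidLaw κ) (fun j x => h (shiftSeq (j * m + ρ) x))
      ((measurePreserving_shiftSeq κ _).integrable_comp_of_integrable hi) ?_ ?_
    · rwa [hint] at this
    · intro i j hij
      rcases lt_or_gt_of_ne hij with h | h
      · exact hind _ _ (by nlinarith)
      · exact (hind _ _ (by nlinarith)).symm
    · intro i
      exact IdentDistrib.comp ⟨(measurable_shiftSeq _).aemeasurable,
        (measurable_shiftSeq _).aemeasurable,
        (measurePreserving_shiftSeq κ _).map_eq.trans (measurePreserving_shiftSeq κ _).map_eq.symm⟩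
        hm
  filter_upwards [ae_all_iff.2 hres] with x hx
  set L := ∫ x, h x ∂(iidLaw κ)
  set u : ℕ → ℝ := fun i => h (shiftSeq i x) with hu
  have hblock : ∀ n, ∑ i ∈ Finset.range (n * m), u i
      = ∑ ρ ∈ Finset.range m, ∑ j ∈ Finset.range n, u (j * m + ρ) := by
    intro n
    induction n with
    | zero => simp
    | succ n ih =>
      rw [add_mul, one_mul, Finset.sum_range_add, ih, ← Finset.sum_add_distrib]
      exact Finset.sum_congr rfl fun ρ _ => by rw [Finset.sum_range_succ]
  have hsub : Tendsto (fun n : ℕ => (∑ i ∈ Finset.range (n * m), u i) / ((n * m : ℕ) : ℝ)) atTop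
      (𝓝 L) := by
    have h1 : Tendsto (fun n : ℕ => (∑ ρ ∈ Finset.range m,
        (∑ j ∈ Finset.range n, u (j * m + ρ)) / n) / m) atTop
        (𝓝 ((∑ ρ ∈ Finset.range m, L) / m)) :=
      (tendsto_finsetSum _ fun ρ _ => hx ρ).div_const _
    have hm' : (m : ℝ) ≠ 0 := by positivity
    rw [Finset.sum_const, Finset.card_range, nsmul_eq_mul, mul_div_cancel_left₀ _ hm'] at h1
    refine h1.congr fun n => ?_
    rw [hblock, ← Finset.sum_div, div_div]
    push_cast
    rfl
  -- The partial sums are monotone because `h ≥ 0`, so convergence along multiples of `m` is enough.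
  refine tendsto_div_of_monotone_of_exists_subseq_tendsto_div _ _ ?_ fun a ha => ?_
  · exact monotone_nat_of_le_succ fun n => by
      rw [Finset.sum_range_succ]
      exact le_add_of_nonneg_right (h0 _)
  · refine ⟨fun n => n * m, ?_, tendsto_id.atTop_mul_const' hm0, hsub⟩
    filter_upwards [(tendsto_natCast_atTop_atTop (R := ℝ)).eventually_ge_atTop (1 / (a - 1))]
      with n hn
    have : 0 < a - 1 := by linarith
    rw [div_le_iff₀ this] at hn
    push_cast
    have hm' : (0 : ℝ) ≤ m := by positivity
    nlinarith

/-! ### The Lindley recursion -/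

/-- The sojourn times of the successive customers of a queue, starting from `w`, with arrival gaps
`a` and services `s`. -/
def lindley (w : ℝ) (a s : ℕ → ℝ) : ℕ → ℝ
  | 0 => w
  | i + 1 => max (lindley w a s i - a i) 0 + s i

/-- Once both `u i ≤ a i` and `v i ≤ a i`, both recursions restart from `s i` and agree forever. If
this never happened, `max u v` would move by `s - a` at each step and become negative, and then both
terms would lie below the nonnegative gap. -/
lemma eventually_eq_of_lindley {a s u v : ℕ → ℝ} (ha : ∀ᶠ i in atTop, 0 ≤ a i)
    (hsum : Tendsto (fun n => ∑ i ∈ Finset.range n, (s i - a i)) atTop atBot)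
    (hu : ∀ᶠ i in atTop, u (i + 1) = max (u i - a i) 0 + s i)
    (hv : ∀ᶠ i in atTop, v (i + 1) = max (v i - a i) 0 + s i) : ∀ᶠ i in atTop, u i = v i := by
  obtain ⟨N, hN⟩ := eventually_atTop.1 (ha.and (hu.and hv))
  suffices h : ∃ i ≥ N, u i ≤ a i ∧ v i ≤ a i by
    obtain ⟨i, hi, h1, h2⟩ := h
    refine eventually_atTop.2 ⟨i + 1, fun j hj => ?_⟩
    induction j, hj using Nat.le_induction with
    | base =>
      rw [(hN i hi).2.1, (hN i hi).2.2, max_eq_right (by linarith), max_eq_right (by linarith)]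
    | succ j hj ih => rw [(hN j (by omega)).2.1, (hN j (by omega)).2.2, ih]
  by_contra hc
  push Not at hc
  have hstep : ∀ j ≥ N, max (u (j + 1)) (v (j + 1)) = max (u j) (v j) - a j + s j := by
    intro j hj
    have h1 : a j < max (u j) (v j) := by
      by_cases h : u j ≤ a j
      · exact lt_max_of_lt_right (hc j hj h)
      · exact lt_max_of_lt_left (not_le.1 h)
    rw [(hN j hj).2.1, (hN j hj).2.2]
    rcases le_total (u j) (v j) with h | h
    · rw [max_eq_right h] at h1 ⊢
      rw [max_eq_left (a := v j - a j) (by linarith), max_eq_right]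
      gcongr
      exact max_le (by linarith) (by linarith)
    · rw [max_eq_left h] at h1 ⊢
      rw [max_eq_left (a := u j - a j) (by linarith), max_eq_left]
      gcongr
      exact max_le (by linarith) (by linarith)
  have hsum2 : ∀ k, max (u (N + k)) (v (N + k)) =
      max (u N) (v N) - ∑ i ∈ Finset.range N, (s i - a i)
        + ∑ i ∈ Finset.range (N + k), (s i - a i) := by
    intro k
    induction k with
    | zero => simp
    | succ k ih =>
      rw [← add_assoc, hstep _ (by omega), ih, Finset.sum_range_succ]
      ring
  obtain ⟨k, hk⟩ := ((hsum.comp (tendsto_add_atTop_nat N)).eventually_lt_atBot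
    (-(max (u N) (v N) - ∑ i ∈ Finset.range N, (s i - a i)))).exists
  simp only [Function.comp, add_comm k N] at hk
  have h1 := hsum2 k
  have h2 : max (u (N + k)) (v (N + k)) < 0 := by linarith
  have h3 := (hN (N + k) (by omega)).1
  have h4 := max_lt_iff.1 h2
  have h5 := hc (N + k) (by omega) (by linarith)
  linarith

/-! ### The stationary queue -/

/-- One step of the queue: the next sojourn time, and the following gaps and services. -/
def queueStep (x : ℝ × (ℕ → ℝ × ℝ)) : ℝ × (ℕ → ℝ × ℝ) :=
  (max (x.1 - (x.2 0).1) 0 + (x.2 0).2, shiftSeq 1 x.2)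

/-- The gap between the first two departures. -/
def departureGap (x : ℝ × (ℕ → ℝ × ℝ)) : ℝ := (x.2 0).2 + max ((x.2 0).1 - x.1) 0

/-- The sojourn times. -/
def sojourn (x : ℝ × (ℕ → ℝ × ℝ)) : ℕ → ℝ :=
  lindley x.1 (fun i => (x.2 i).1) (fun i => (x.2 i).2)

lemma measurable_queueStep : Measurable queueStep := by
  unfold queueStep shiftSeq; fun_prop

lemma measurable_departureGap : Measurable departureGap := by
  unfold departureGap; fun_prop

lemma measurable_sojourn (i : ℕ) : Measurable fun x => sojourn x i := by
  induction i with
  | zero => exact measurable_fst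
  | succ i ih =>
    have h : Measurable fun x : ℝ × (ℕ → ℝ × ℝ) => max (sojourn x i - (x.2 i).1) 0 + (x.2 i).2 := by
      fun_prop
    exact h

lemma queueStep_iterate (x : ℝ × (ℕ → ℝ × ℝ)) (i : ℕ) :
    queueStep^[i] x = (sojourn x i, shiftSeq i x.2) := by
  induction i with
  | zero => ext <;> simp [sojourn, lindley]
  | succ i ih =>
    rw [Function.iterate_succ_apply', ih]
    refine Prod.ext ?_ ?_
    · simp only [queueStep, sojourn, lindley, shiftSeq_apply, add_zero]
    · funext j
      simp only [queueStep, shiftSeq_apply]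
      rw [add_assoc]

section Stationary

variable (β : ℝ) [Fact (1 < β)]

instance : IsProbabilityMeasure (expMeasure β) :=
  isProbabilityMeasure_expMeasure (by have : 1 < β := Fact.out; linarith)

instance : IsProbabilityMeasure (expMeasure (β - 1)) :=
  isProbabilityMeasure_expMeasure (by have : 1 < β := Fact.out; linarith)

instance : IsProbabilityMeasure (expMeasure 1) := isProbabilityMeasure_expMeasure one_pos

/-- The law of a stationary queue with arrival rate `1` and service rate `β`. -/
def queueLaw : Measure (ℝ × (ℕ → ℝ × ℝ)) :=
  (expMeasure (β - 1)).prod (iidLaw ((expMeasure 1).prod (expMeasure β)))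

instance : IsProbabilityMeasure (queueLaw β) := by unfold queueLaw; infer_instance

lemma measurePreserving_departureGap_queueStep :
    MeasurePreserving (fun x => (departureGap x, queueStep x)) (queueLaw β)
      ((expMeasure 1).prod (queueLaw β)) := by
  have h1 := (MeasurePreserving.id (expMeasure (β - 1))).prod
    (measurePreserving_headTail ((expMeasure 1).prod (expMeasure β)))
  have h2 := (measurePreserving_prodAssoc (expMeasure (β - 1))
    ((expMeasure 1).prod (expMeasure β)) (iidLaw ((expMeasure 1).prod (expMeasure β)))).symm
  have h3 := (measurePreserving_burke (β := β) Fact.out).prod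
    (MeasurePreserving.id (iidLaw ((expMeasure 1).prod (expMeasure β))))
  have h4 := measurePreserving_prodAssoc (expMeasure 1) (expMeasure (β - 1))
    (iidLaw ((expMeasure 1).prod (expMeasure β)))
  exact h4.comp (h3.comp (h2.comp h1))

lemma measurePreserving_queueStep : MeasurePreserving queueStep (queueLaw β) (queueLaw β) :=
  measurePreserving_snd.comp (measurePreserving_departureGap_queueStep β)

/-- Burke's theorem: the gaps between the departures of the stationary queue are independent
exponential variables. -/
lemma measurePreserving_departureGaps :
    MeasurePreserving (fun x i => departureGap (queueStep^[i] x)) (queueLaw β)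
      (iidLaw (expMeasure 1)) := by
  have h := measurePreserving_draw (Z := Unit) (Φ := fun _ x => (departureGap x, queueStep x))
    (U := fun _ _ => ()) (ν := queueLaw β) (κ := expMeasure 1)
    ((measurable_departureGap.prodMk measurable_queueStep).comp measurable_snd)
    measurable_const (fun _ => measurePreserving_departureGap_queueStep β) ()
  convert h using 1
  funext x i
  have h1 : ∀ i, ((drawStep (fun _ x => (departureGap x, queueStep x))
      (fun (_ : Unit) (_ : ℝ) => ()))^[i] ((), x)).2 = queueStep^[i] x := by
    intro i
    induction i with
    | zero => rfl
    | succ i ih => rw [Function.iterate_succ_apply', Function.iterate_succ_apply', ← ih]; rfl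
  rw [draw, h1]

lemma ae_sum_service_sub_gap_tendsto :
    ∀ᵐ ξ ∂(iidLaw ((expMeasure 1).prod (expMeasure β))),
      Tendsto (fun n => ∑ i ∈ Finset.range n, ((ξ i).2 - (ξ i).1)) atTop atBot := by
  have hβ : 1 < β := Fact.out
  have i1 : Integrable (fun z : ℝ × ℝ => z.1) ((expMeasure 1).prod (expMeasure β)) :=
    measurePreserving_fst.integrable_comp_of_integrable (integrable_id_expMeasure one_pos)
  have i2 : Integrable (fun z : ℝ × ℝ => z.2) ((expMeasure 1).prod (expMeasure β)) :=
    measurePreserving_snd.integrable_comp_of_integrable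
      (integrable_id_expMeasure (r := β) (by linarith))
  filter_upwards [ae_tendsto_average_eval ((expMeasure 1).prod (expMeasure β))
    (f := fun z => z.1 - z.2) (by fun_prop) (i1.sub i2)] with ξ hξ
  have h1 : ∫ z, z.1 - z.2 ∂((expMeasure 1).prod (expMeasure β)) = 1 - 1 / β := by
    rw [integral_sub i1 i2, integral_fun_fst (fun x : ℝ => x), integral_fun_snd (fun x : ℝ => x),
      integral_id_expMeasure one_pos, integral_id_expMeasure (by linarith)]
    simp
  have h2 : 0 < 1 - 1 / β := by
    rw [sub_pos, div_lt_one (by linarith)]; exact hβ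
  rw [h1] at hξ
  have h3 := tendsto_neg_atTop_atBot.comp (tendsto_atTop_of_average h2 hξ)
  refine h3.congr fun n => ?_
  simp only [Function.comp, ← Finset.sum_neg_distrib, neg_sub]

lemma ae_gap_pos : ∀ᵐ ξ ∂(iidLaw ((expMeasure 1).prod (expMeasure β))), ∀ i, 0 < (ξ i).1 :=
  ae_all_iff.2 fun i => (measurePreserving_fst.comp
    (measurePreserving_eval_iid _ i)).quasiMeasurePreserving.ae (expMeasure_ae_pos one_pos)

lemma abs_lindley_sub_le (w w' : ℝ) (a s : ℕ → ℝ) (i : ℕ) :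
    |lindley w a s i - lindley w' a s i| ≤ |w - w'| := by
  induction i with
  | zero => exact le_rfl
  | succ i ih =>
    refine le_trans ?_ ih
    simp only [lindley, add_sub_add_right_eq_sub]
    refine (abs_max_sub_max_le_abs _ _ _).trans_eq ?_
    congr 1; ring

/-- The ergodic theorem for functions of the stationary queue. -/
theorem ae_longRunAverage_queue {φ : ℝ × (ℕ → ℝ × ℝ) → ℝ} (hm : Measurable φ)
    (hi : Integrable φ (queueLaw β)) (h0 : 0 ≤ φ)
    (hlip : ∀ w w' ξ, |φ (w, ξ) - φ (w', ξ)| ≤ |w - w'|) {d : ℕ}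
    (hdep : ∀ w ξ ξ', (∀ i < d, ξ i = ξ' i) → φ (w, ξ) = φ (w, ξ')) :
    ∀ᵐ x ∂(queueLaw β), HasLongRunAverage (fun i => φ (sojourn x i, shiftSeq i x.2))
      (∫ x, φ x ∂(queueLaw β)) := by
  have hβ : 1 < β := Fact.out
  have hT := measurePreserving_queueStep β
  set η := iidLaw ((expMeasure 1).prod (expMeasure β)) with hη
  have hsnd : MeasurePreserving (Prod.snd : ℝ × (ℕ → ℝ × ℝ) → _) (queueLaw β) η :=
    measurePreserving_snd
  have hfst : MeasurePreserving (Prod.fst : ℝ × (ℕ → ℝ × ℝ) → _) (queueLaw β)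
    (expMeasure (β - 1)) := measurePreserving_fst
  -- The error of forgetting the initial sojourn time after `r` steps: it is dominated by `|x.1|`
  -- and eventually vanishes, so its integral tends to 0.
  set g : ℕ → ℝ × (ℕ → ℝ × ℝ) → ℝ := fun r x => |sojourn x r - sojourn (0, x.2) r| with hg
  have hgm : ∀ r, Measurable (g r) := fun r =>
    ((measurable_sojourn r).sub ((measurable_sojourn r).comp (by fun_prop))).norm
  have hwi : Integrable (fun x : ℝ × (ℕ → ℝ × ℝ) => |x.1|) (queueLaw β) :=
    hfst.integrable_comp_of_integrable (integrable_id_expMeasure (r := β - 1) (by linarith)).abs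
  have hgw : ∀ r x, g r x ≤ |x.1| := fun r x => by
    simpa [hg, sojourn] using abs_lindley_sub_le x.1 0 (fun i => (x.2 i).1) (fun i => (x.2 i).2) r
  have hg0 : ∀ r, 0 ≤ g r := fun r x => abs_nonneg _
  have hgi : ∀ r, Integrable (g r) (queueLaw β) := fun r =>
    hwi.mono' (hgm r).aestronglyMeasurable (ae_of_all _ fun x => by
      rw [Real.norm_eq_abs, abs_of_nonneg (hg0 r x)]; exact hgw r x)
  have hglim : Tendsto (fun r => ∫ x, g r x ∂(queueLaw β)) atTop (𝓝 0) := by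
    rw [← integral_zero (ℝ × (ℕ → ℝ × ℝ)) ℝ (μ := queueLaw β)]
    refine tendsto_integral_of_dominated_convergence (fun x => |x.1|)
      (fun r => (hgm r).aestronglyMeasurable) hwi (fun r => ae_of_all _ fun x => ?_) ?_
    · rw [Real.norm_eq_abs, abs_of_nonneg (hg0 r x)]; exact hgw r x
    · filter_upwards [hsnd.quasiMeasurePreserving.ae (ae_sum_service_sub_gap_tendsto β),
        hsnd.quasiMeasurePreserving.ae (ae_gap_pos β)] with x h1 h2
      have := eventually_eq_of_lindley (u := sojourn x) (v := sojourn (0, x.2))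
        (.of_forall fun i => (h2 i).le) h1 (.of_forall fun i => rfl) (.of_forall fun i => rfl)
      refine tendsto_const_nhds.congr' ?_
      filter_upwards [this] with r hr
      simp [hg, hr]
  -- The value of `φ` after `r` steps from initial sojourn time 0; it depends only on the first `r +
  -- d` inputs.
  set ψ : ℕ → (ℕ → ℝ × ℝ) → ℝ := fun r ξ => φ (sojourn (0, ξ) r, shiftSeq r ξ) with hψ
  have hψm : ∀ r, Measurable (ψ r) := fun r =>
    hm.comp (((measurable_sojourn r).comp (by fun_prop)).prodMk (measurable_shiftSeq r))
  have hφT : ∀ r x, φ (queueStep^[r] x) = φ (sojourn x r, shiftSeq r x.2) := fun r x => by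
    rw [queueStep_iterate]
  have hTi : ∀ r, Integrable (fun x => φ (queueStep^[r] x)) (queueLaw β) := fun r =>
    (hT.iterate r).integrable_comp_of_integrable hi
  have hcmp : ∀ r x, |φ (queueStep^[r] x) - ψ r x.2| ≤ g r x := fun r x => by
    rw [hφT]; exact hlip _ _ _
  have hψi' : ∀ r, Integrable (fun x : ℝ × (ℕ → ℝ × ℝ) => ψ r x.2) (queueLaw β) := fun r => by
    have h1 : Integrable (fun x : ℝ × (ℕ → ℝ × ℝ) => ψ r x.2 - φ (queueStep^[r] x))
        (queueLaw β) :=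
      (hgi r).mono' (((hψm r).comp measurable_snd).sub
        (hm.comp (hT.iterate r).measurable)).aestronglyMeasurable
        (ae_of_all _ fun x => by rw [Real.norm_eq_abs, abs_sub_comm]; exact hcmp r x)
    exact (h1.add (hTi r)).congr (ae_of_all _ fun x => by simp)
  have hψi : ∀ r, Integrable (ψ r) η := fun r =>
    (hsnd.integrable_comp (hψm r).aestronglyMeasurable).1 (hψi' r)
  have hint : ∀ r, |∫ ξ, ψ r ξ ∂η - ∫ x, φ x ∂(queueLaw β)| ≤ ∫ x, g r x ∂(queueLaw β) := by
    intro r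
    have e1 : ∫ ξ, ψ r ξ ∂η = ∫ x, ψ r x.2 ∂(queueLaw β) := by
      have := integral_map (μ := queueLaw β) measurable_snd.aemeasurable (f := ψ r)
        (hψm r).aestronglyMeasurable
      rwa [hsnd.map_eq] at this
    have e2 : ∫ x, φ x ∂(queueLaw β) = ∫ x, φ (queueStep^[r] x) ∂(queueLaw β) := by
      have := integral_map (μ := queueLaw β) (hT.iterate r).measurable.aemeasurable (f := φ)
        hm.aestronglyMeasurable
      rwa [(hT.iterate r).map_eq] at this
    rw [e1, e2, ← integral_sub (hψi' r) (hTi r)]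
    refine (abs_integral_le_integral_abs).trans (integral_mono ((hψi' r).sub (hTi r)).abs (hgi r) ?_)
    intro x
    simp only
    rw [abs_sub_comm]
    exact hcmp r x
  have hψavg : ∀ r, ∀ᵐ x ∂(queueLaw β), HasLongRunAverage (fun i => ψ r (shiftSeq i x.2))
      (∫ ξ, ψ r ξ ∂η) := fun r => by
    refine hsnd.quasiMeasurePreserving.ae (ae_longRunAverage_shiftSeq _ (hψm r) (hψi r)
      (fun ξ => h0 _) (m := r + d + 1) (by omega) fun ξ ξ' hξ => ?_)
    have h1 : ∀ k ≤ r, sojourn (0, ξ) k = sojourn (0, ξ') k := by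
      intro k
      induction k with
      | zero => intro _; rfl
      | succ k ih =>
        intro hk
        have h2 := ih (by omega)
        simp only [sojourn, lindley] at h2 ⊢
        rw [h2, hξ k (by omega)]
    simp only [hψ]
    rw [h1 r le_rfl]
    exact hdep _ _ _ fun i hi => hξ _ (by omega)
  filter_upwards [ae_all_iff.2 hψavg, ae_forall_exists_sum_iterate_le hT hgm hgi hg0 hglim]
    with x hx1 hx2
  refine .of_approx fun ε hε => ?_
  obtain ⟨r, hr1, hr2⟩ := ((hx2 ε hε).and_eventually
    (hglim.eventually_le_const hε)).exists
  refine ⟨r, _, _, (hint r).trans hr2, hx1 r, fun n => ?_⟩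
  refine (Finset.abs_sum_le_sum_abs _ _).trans ((Finset.sum_le_sum fun i _ => ?_).trans (hr1 n))
  -- At step `r + i`, compare the queue with the one whose sojourn time was reset to 0 at step `i`.
  have h1 := hcmp r (queueStep^[i] x)
  rw [← Function.iterate_add_apply, hφT] at h1
  rwa [queueStep_iterate x i] at h1 ⊢

end Stationary

/-! ### Stationary means of the remaining sojourn and lead times -/

section Stationary

variable (β : ℝ) [Fact (1 < β)]

/-- The sum of the first `d` gaps. -/
def gapSum (d : ℕ) (ξ : ℕ → ℝ × ℝ) : ℝ := ∑ j ∈ Finset.range d, (ξ j).1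

lemma measurable_gapSum (d : ℕ) : Measurable (gapSum d) := by
  unfold gapSum; fun_prop

lemma measurePreserving_gap (j : ℕ) : MeasurePreserving (fun ξ : ℕ → ℝ × ℝ => (ξ j).1)
    (iidLaw ((expMeasure 1).prod (expMeasure β))) (expMeasure 1) :=
  measurePreserving_fst.comp (measurePreserving_eval_iid _ j)

lemma integrable_gapSum (d : ℕ) :
    Integrable (gapSum d) (iidLaw ((expMeasure 1).prod (expMeasure β))) :=
  integrable_finsetSum _ fun j _ =>
    (measurePreserving_gap β j).integrable_comp_of_integrable (integrable_id_expMeasure one_pos)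

lemma integral_gapSum (d : ℕ) :
    ∫ ξ, gapSum d ξ ∂(iidLaw ((expMeasure 1).prod (expMeasure β))) = d := by
  have h : ∀ j, ∫ ξ, (ξ j).1 ∂(iidLaw ((expMeasure 1).prod (expMeasure β))) = 1 := fun j => by
    have := integral_map (μ := iidLaw ((expMeasure 1).prod (expMeasure β)))
      (measurePreserving_gap β j).measurable.aemeasurable (f := fun x : ℝ => x) (by fun_prop)
    rw [(measurePreserving_gap β j).map_eq, integral_id_expMeasure one_pos] at this
    rw [← this, div_one]
  have hi : ∀ j, Integrable (fun ξ : ℕ → ℝ × ℝ => (ξ j).1)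
      (iidLaw ((expMeasure 1).prod (expMeasure β))) := fun j =>
    (measurePreserving_gap β j).integrable_comp_of_integrable (integrable_id_expMeasure one_pos)
  unfold gapSum
  rw [integral_finsetSum _ fun j _ => hi j]
  simp [h]

/-- By independence the transform is a product of `d` factors `1 / (1 + (β - 1))`. -/
lemma integral_exp_gapSum (d : ℕ) :
    ∫ ξ, Real.exp (-((β - 1) * gapSum d ξ)) ∂(iidLaw ((expMeasure 1).prod (expMeasure β)))
      = (1 / β) ^ d := by
  have hβ : 1 < β := Fact.out
  have hind : iIndepFun (fun (j : ℕ) (ξ : ℕ → ℝ × ℝ) => (ξ j).1)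
      (iidLaw ((expMeasure 1).prod (expMeasure β))) :=
    (iIndepFun_eval _).comp (fun _ (z : ℝ × ℝ) => z.1) (fun _ => measurable_fst)
  have h1 := hind.mgf_sum (t := -(β - 1)) (fun j => by fun_prop) (Finset.range d)
  have h2 : ∀ j, mgf (fun ξ : ℕ → ℝ × ℝ => (ξ j).1)
      (iidLaw ((expMeasure 1).prod (expMeasure β))) (-(β - 1)) = 1 / β := fun j => by
    have := integral_map (μ := iidLaw ((expMeasure 1).prod (expMeasure β)))
      (measurePreserving_gap β j).measurable.aemeasurable
      (f := fun x : ℝ => Real.exp (-((β - 1) * x))) (by fun_prop)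
    rw [(measurePreserving_gap β j).map_eq,
      integral_exp_neg_expMeasure one_pos (by linarith)] at this
    rw [mgf]
    simp only [neg_mul]
    rw [← this]
    ring
  simp only [h2, Finset.prod_const, Finset.card_range] at h1
  rw [← h1, mgf]
  refine integral_congr_ae (ae_of_all _ fun ξ => ?_)
  simp only [gapSum, Finset.sum_apply, neg_mul]

/-- The remaining sojourn time at the `d`-th following arrival. -/
def remaining (d : ℕ) (x : ℝ × (ℕ → ℝ × ℝ)) : ℝ := max (x.1 - gapSum d x.2) 0

/-- The time from the departure to the `d`-th following arrival. -/
def leadTime (d : ℕ) (x : ℝ × (ℕ → ℝ × ℝ)) : ℝ := max (gapSum d x.2 - x.1) 0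

lemma measurable_remaining (d : ℕ) : Measurable (remaining d) :=
  (measurable_fst.sub ((measurable_gapSum d).comp measurable_snd)).max measurable_const

lemma measurable_leadTime (d : ℕ) : Measurable (leadTime d) :=
  (((measurable_gapSum d).comp measurable_snd).sub measurable_fst).max measurable_const

lemma integrable_fst_queueLaw : Integrable (fun x => x.1) (queueLaw β) :=
  measurePreserving_fst.integrable_comp_of_integrable
    (integrable_id_expMeasure (r := β - 1) (by have : 1 < β := Fact.out; linarith))

lemma integrable_gapSum_queueLaw (d : ℕ) : Integrable (fun x => gapSum d x.2) (queueLaw β) :=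
  measurePreserving_snd.integrable_comp_of_integrable (integrable_gapSum β d)

lemma integrable_remaining (d : ℕ) : Integrable (remaining d) (queueLaw β) :=
  ((integrable_fst_queueLaw β).sub (integrable_gapSum_queueLaw β d)).sup (integrable_zero _ _ _)

lemma integrable_leadTime (d : ℕ) : Integrable (leadTime d) (queueLaw β) :=
  ((integrable_gapSum_queueLaw β d).sub (integrable_fst_queueLaw β)).sup (integrable_zero _ _ _)

/-- Integrate first over the sojourn time, which is independent of the gaps: its excess over `t` has
mean `exp (-((β - 1) * t)) / (β - 1)`. What is left is the transform of `gapSum`. -/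
lemma integral_remaining (d : ℕ) :
    ∫ x, remaining d x ∂(queueLaw β) = (1 / β) ^ d / (β - 1) := by
  have hβ : 1 < β := Fact.out
  have hi := integrable_remaining β d
  rw [queueLaw] at hi ⊢
  rw [integral_prod_symm _ hi]
  have h1 : ∀ᵐ ξ ∂(iidLaw ((expMeasure 1).prod (expMeasure β))),
      ∫ w, remaining d (w, ξ) ∂(expMeasure (β - 1))
        = Real.exp (-((β - 1) * gapSum d ξ)) / (β - 1) := by
    filter_upwards [ae_gap_pos β] with ξ hξ
    exact integral_sub_pos_expMeasure (by linarith) (Finset.sum_nonneg fun j _ => (hξ j).le)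
  rw [integral_congr_ae h1, integral_div, integral_exp_gapSum]

lemma integral_leadTime (d : ℕ) :
    ∫ x, leadTime d x ∂(queueLaw β) = (1 / β) ^ d / (β - 1) - 1 / (β - 1) + d := by
  have hβ : 1 < β := Fact.out
  have h1 : leadTime d = fun x => remaining d x - x.1 + gapSum d x.2 := by
    funext x
    simp only [leadTime, remaining]
    rcases le_total x.1 (gapSum d x.2) with h | h
    · rw [max_eq_left (by linarith), max_eq_right (by linarith)]; ring
    · rw [max_eq_right (by linarith), max_eq_left (by linarith)]; ring
  have h2 : ∫ x, x.1 ∂(queueLaw β) = 1 / (β - 1) := by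
    rw [queueLaw, integral_fun_fst (fun x : ℝ => x), integral_id_expMeasure (by linarith)]
    simp
  have h3 : ∫ x, gapSum d x.2 ∂(queueLaw β) = d := by
    rw [queueLaw, integral_fun_snd (gapSum d), integral_gapSum]
    simp
  have h4 : Integrable (fun x => remaining d x - x.1) (queueLaw β) :=
    (integrable_remaining β d).sub (integrable_fst_queueLaw β)
  rw [h1, integral_add h4 (integrable_gapSum_queueLaw β d), integral_sub (integrable_remaining β d)
    (integrable_fst_queueLaw β), integral_remaining, h2, h3]

lemma ae_longRunAverage_remaining (d : ℕ) :
    ∀ᵐ x ∂(queueLaw β), HasLongRunAverage (fun i => remaining d (sojourn x i, shiftSeq i x.2))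
      ((1 / β) ^ d / (β - 1)) := by
  rw [← integral_remaining]
  refine ae_longRunAverage_queue β (measurable_remaining d) (integrable_remaining β d)
    (fun _ => le_max_right _ _) (fun w w' ξ => ?_) (d := d) fun w ξ ξ' h => ?_
  · refine (abs_max_sub_max_le_abs _ _ _).trans_eq ?_
    congr 1; ring
  · have : gapSum d ξ = gapSum d ξ' :=
      Finset.sum_congr rfl fun i hi => by rw [h i (Finset.mem_range.1 hi)]
    simp only [remaining, this]

lemma ae_longRunAverage_leadTime (d : ℕ) :
    ∀ᵐ x ∂(queueLaw β), HasLongRunAverage (fun i => leadTime d (sojourn x i, shiftSeq i x.2))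
      ((1 / β) ^ d / (β - 1) - 1 / (β - 1) + d) := by
  rw [← integral_leadTime]
  refine ae_longRunAverage_queue β (measurable_leadTime d) (integrable_leadTime β d)
    (fun _ => le_max_right _ _) (fun w w' ξ => ?_) (d := d) fun w ξ ξ' h => ?_
  · refine (abs_max_sub_max_le_abs _ _ _).trans_eq ?_
    rw [abs_sub_comm]; congr 1; ring
  · have : gapSum d ξ = gapSum d ξ' :=
      Finset.sum_congr rfl fun i hi => by rw [h i (Finset.mem_range.1 hi)]
    simp only [leadTime, this]

end Stationary

/-! ### The second queue -/

/-- The parameters of the second queue are the time of the last departure and the arrival times of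
the customers still to be served; the source is the dispatch process after the last departure. -/
def dispatchDraw (z : ℝ × (ℕ → ℝ)) (r : ℕ → ℝ) : ℝ × (ℕ → ℝ) :=
  restart (max (z.2 0 - z.1) 0) r

/-- The parameters after a service of length `y`. -/
def dispatchUpdate (z : ℝ × (ℕ → ℝ)) (y : ℝ) : ℝ × (ℕ → ℝ) :=
  (max (z.2 0) z.1 + y, shiftSeq 1 z.2)

/-- The times from the instants at which the customers, with arrival times `c`, get to the head of
the queue to the next dispatch instants. -/
def dispatchService (c r : ℕ → ℝ) : ℕ → ℝ := draw dispatchDraw dispatchUpdate ((0, c), r)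

/-- The departure time of the customer before customer `i` (`0` if there is none). -/
def lastDeparture (c r : ℕ → ℝ) (i : ℕ) : ℝ :=
  ((drawStep dispatchDraw dispatchUpdate)^[i] ((0, c), r)).1.1

lemma measurable_dispatchDraw : Measurable (Function.uncurry dispatchDraw) := by
  have h : Measurable fun p : (ℝ × (ℕ → ℝ)) × (ℕ → ℝ) => (max (p.1.2 0 - p.1.1) 0, p.2) := by
    fun_prop
  exact measurable_restart.comp h

lemma measurable_dispatchUpdate : Measurable (Function.uncurry dispatchUpdate) := by
  have h : Measurable fun p : (ℝ × (ℕ → ℝ)) × ℝ =>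
      (max (p.1.2 0) p.1.1 + p.2, shiftSeq 1 p.1.2) := by
    unfold shiftSeq; fun_prop
  exact h

lemma measurable_dispatchService :
    Measurable (fun p : (ℕ → ℝ) × (ℕ → ℝ) => dispatchService p.1 p.2) :=
  (measurable_draw measurable_dispatchDraw measurable_dispatchUpdate).comp (by fun_prop)

/-- Each customer restarts the dispatch process on reaching the head of the queue, at a delay after
the last departure that is known by then. The arrival times `c` are arbitrary but fixed, so the
resulting law does not depend on them. -/
lemma measurePreserving_dispatchService {l : ℝ} (hl : 0 < l)
    [IsProbabilityMeasure (expMeasure l)] (c : ℕ → ℝ) :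
    MeasurePreserving (dispatchService c) (iidLaw (expMeasure l)) (iidLaw (expMeasure l)) :=
  measurePreserving_draw measurable_dispatchDraw measurable_dispatchUpdate
    (fun _ => measurePreserving_restart hl (le_max_right _ _)) (0, c)

lemma sum_shiftSeq (r : ℕ → ℝ) (N j : ℕ) :
    eventTime (shiftSeq N r) j
      = ∑ k ∈ Finset.range (N + j + 1), r k - ∑ k ∈ Finset.range N, r k := by
  rw [add_assoc, Finset.sum_range_add]
  simp [eventTime]

/-- This identifies the departures of the abstract queue with the dispatch instants that satisfy
`p`. After `i` services the first `N` instants are used up, exactly `i` of them effective, and the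
source is the untouched rest of the gaps. -/
lemma drawStep_dispatch_iterate {c r : ℕ → ℝ} (hr : ∀ i, 0 < r i)
    (hlim : Tendsto (fun n => ∑ i ∈ Finset.range n, r i) atTop atTop) {p : ℕ → Prop}
    [DecidablePred p] (hp : ∀ j, p j ↔ c (Nat.count p j) < eventTime r j) (i : ℕ) :
    ∃ N, (drawStep dispatchDraw dispatchUpdate)^[i] ((0, c), r)
        = ((∑ k ∈ Finset.range N, r k, shiftSeq i c), shiftSeq N r) ∧ Nat.count p N = i ∧
      lastDeparture c r (i + 1) = eventTime r (Nat.nth p i) := by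
  classical
  have step : ∀ i N, (drawStep dispatchDraw dispatchUpdate)^[i] ((0, c), r)
        = ((∑ k ∈ Finset.range N, r k, shiftSeq i c), shiftSeq N r) → Nat.count p N = i →
      ∃ N', (drawStep dispatchDraw dispatchUpdate)^[i + 1] ((0, c), r)
        = ((∑ k ∈ Finset.range N', r k, shiftSeq (i + 1) c), shiftSeq N' r) ∧
        Nat.count p N' = i + 1 ∧ ∑ k ∈ Finset.range N', r k = eventTime r (Nat.nth p i) := by
    intro i N h1 h2
    set S := ∑ k ∈ Finset.range N, r k with hS
    set t := max (c i - S) 0 with ht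
    have hex : ∃ j, t < eventTime (shiftSeq N r) j := by
      obtain ⟨n, hn⟩ := ((hlim.comp (tendsto_add_atTop_nat (N + 1))).eventually_gt_atTop
        (t + S)).exists
      refine ⟨n, ?_⟩
      rw [sum_shiftSeq]
      simp only [Function.comp] at hn
      rw [show N + n + 1 = n + (N + 1) by ring]
      linarith
    set j₀ := Nat.find hex with hj
    have hj1 : t < eventTime (shiftSeq N r) j₀ := Nat.find_spec hex
    have hj2 : ∀ j < j₀, eventTime (shiftSeq N r) j ≤ t := fun j hj =>
      not_lt.1 (Nat.find_min hex hj)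
    have hfirst := firstAfter_eq_iff hj1 hj2
    have hpos : ∀ j, 0 < eventTime (shiftSeq N r) j := fun j =>
      Finset.sum_pos (fun k _ => hr _) (by simp)
    -- The instants before `j₀` come no later than the arrival of customer `i`, so the queue is
    -- empty and they are lost.
    have hcount : ∀ j ≤ j₀, Nat.count p (N + j) = i := by
      intro j
      induction j with
      | zero => intro _; exact h2
      | succ j ih =>
        intro hle
        have h3 := ih (by omega)
        have h4 : ¬ p (N + j) := by
          rw [hp, h3, not_lt]
          have h5 := hj2 j (by omega)
          have h6 := hpos j
          have h7 : eventTime r (N + j) = eventTime (shiftSeq N r) j + S := by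
            rw [sum_shiftSeq, sub_add_cancel, eventTime]
          rw [h7]
          rcases le_max_iff.1 h5 with h | h <;> linarith
        rw [← add_assoc, Nat.count_succ, if_neg h4, h3, add_zero]
    have hpj : p (N + j₀) := by
      rw [hp, hcount j₀ le_rfl]
      have h7 : eventTime r (N + j₀) = eventTime (shiftSeq N r) j₀ + S := by
        rw [sum_shiftSeq, sub_add_cancel, eventTime]
      rw [h7]
      have := (max_lt_iff.1 hj1).1
      linarith
    have hnth : Nat.nth p i = N + j₀ := by
      have := Nat.nth_count hpj
      rwa [hcount j₀ le_rfl] at this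
    refine ⟨N + j₀ + 1, ?_, ?_, ?_⟩
    · rw [Function.iterate_succ_apply', h1]
      simp only [drawStep, dispatchDraw, dispatchUpdate, restart, shiftSeq_apply, add_zero, ← ht,
        hfirst]
      refine Prod.ext (Prod.ext ?_ ?_) ?_
      · simp only
        rw [sum_shiftSeq, ← hS, ht]
        rcases le_total (c i) S with h | h
        · rw [max_eq_right h, max_eq_right (by linarith)]; ring
        · rw [max_eq_left h, max_eq_left (by linarith)]; ring
      · funext k; simp only [shiftSeq_apply]; congr 1; ring
      · funext k; simp only [shiftSeq_apply]; congr 1; ring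
    · rw [Nat.count_succ, if_pos hpj, hcount j₀ le_rfl]
    · rw [hnth]; rfl
  have main : ∃ N, (drawStep dispatchDraw dispatchUpdate)^[i] ((0, c), r)
        = ((∑ k ∈ Finset.range N, r k, shiftSeq i c), shiftSeq N r) ∧ Nat.count p N = i := by
    induction i with
    | zero => exact ⟨0, by ext <;> simp, by simp⟩
    | succ i ih =>
      obtain ⟨N, h1, h2⟩ := ih
      obtain ⟨N', h3, h4, -⟩ := step i N h1 h2
      exact ⟨N', h3, h4⟩
  obtain ⟨N, h1, h2⟩ := main
  obtain ⟨N', h3, -, h5⟩ := step i N h1 h2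
  exact ⟨N, h1, h2, by rw [lastDeparture, h3, h5]⟩

lemma lastDeparture_succ {c r : ℕ → ℝ} (hr : ∀ i, 0 < r i)
    (hlim : Tendsto (fun n => ∑ i ∈ Finset.range n, r i) atTop atTop) {p : ℕ → Prop}
    [DecidablePred p] (hp : ∀ j, p j ↔ c (Nat.count p j) < eventTime r j) (i : ℕ) :
    lastDeparture c r (i + 1) = max (c i) (lastDeparture c r i) + dispatchService c r i := by
  obtain ⟨N, h1, -, -⟩ := drawStep_dispatch_iterate hr hlim hp i
  have h2 : ((drawStep dispatchDraw dispatchUpdate)^[i] ((0, c), r)).1.2 0 = c i := by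
    rw [h1]; simp
  rw [lastDeparture, Function.iterate_succ_apply', drawStep, dispatchUpdate, h2]
  rfl

/-! ### The system as two queues in tandem -/

namespace Realization

variable (x : Realization)

lemma orderArrival_add (i : ℕ) : x.orderArrival (x.q₁ + i) = eventTime x.orderGap i := by
  simp [orderArrival]

lemma orderReady_of_lt {k : ℕ} (hk : k < x.q₁) (hs : ∀ k, 0 < x.service k) :
    x.orderReady k = ∑ j ∈ Finset.range (k + 1), x.service j := by
  induction k with
  | zero => simp [orderReady, orderArrival, hk]
  | succ k ih =>
    rw [orderReady, ih (by omega), Finset.sum_range_succ _ (k + 1), orderArrival, if_pos hk,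
      max_eq_right (Finset.sum_nonneg fun j _ => (hs j).le)]

/-- The initial orders act as one customer arriving at time 0 whose sojourn time is their total
work. Hence order `q₁ + i` has index `i + 1` in the recursion. -/
lemma orderReady_add (ha : ∀ k, 0 < x.orderGap k) (hs : ∀ k, 0 < x.service k) (i : ℕ) :
    x.orderReady (x.q₁ + i) = eventTime x.orderGap i +
      lindley (∑ k ∈ Finset.range x.q₁, x.service k) x.orderGap (shiftSeq x.q₁ x.service)
        (i + 1) := by
  induction i with
  | zero =>
    have h := x.orderArrival_add 0
    simp only [lindley, shiftSeq_apply, add_zero] at h ⊢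
    rcases Nat.eq_zero_or_pos x.q₁ with h0 | h0
    · have h1 := ha 0
      rw [h0] at h ⊢
      rw [orderReady, h]
      simp [eventTime, h1.le]
    · obtain ⟨k, hk⟩ := Nat.exists_eq_succ_of_ne_zero h0.ne'
      have h1 := x.orderReady_of_lt (k := k) (by omega) hs
      rw [hk, Nat.succ_eq_add_one] at h ⊢
      rw [orderReady, h, h1]
      simp only [eventTime, zero_add, Finset.sum_range_one]
      set B := ∑ j ∈ Finset.range (k + 1), x.service j
      rcases le_total (x.orderGap 0) B with h2 | h2
      · rw [max_eq_right h2, max_eq_left (by linarith)]; ring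
      · rw [max_eq_left h2, max_eq_right (by linarith)]; ring
  | succ i ih =>
    set L := lindley (∑ k ∈ Finset.range x.q₁, x.service k) x.orderGap
      (shiftSeq x.q₁ x.service) (i + 1)
    change _ = _ + (max (L - x.orderGap (i + 1)) 0 + x.service (x.q₁ + (i + 1)))
    have h1 : eventTime x.orderGap (i + 1) = eventTime x.orderGap i + x.orderGap (i + 1) :=
      Finset.sum_range_succ _ _
    rw [← add_assoc, orderReady, add_assoc, x.orderArrival_add, ih, h1]
    rcases le_total (x.orderGap (i + 1)) L with h2 | h2
    · rw [max_eq_right (by linarith), max_eq_left (by linarith)]; ring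
    · rw [max_eq_left (by linarith), max_eq_right (by linarith)]; ring

lemma strictMono_orderReady (hs : ∀ k, 0 < x.service k) : StrictMono x.orderReady :=
  strictMono_nat_of_lt_succ fun k => by
    rw [orderReady]
    have := hs (k + 1)
    have := le_max_right (x.orderArrival (k + 1)) (x.orderReady k)
    linarith

lemma sum_service_le_orderReady (ha : ∀ k, 0 < x.orderGap k) (k : ℕ) :
    ∑ j ∈ Finset.range (k + 1), x.service j ≤ x.orderReady k := by
  induction k with
  | zero =>
    have : 0 ≤ x.orderArrival 0 := by
      unfold orderArrival eventTime
      split_ifs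
      exacts [le_rfl, Finset.sum_nonneg fun _ _ => (ha _).le]
    simp [orderReady, this]
  | succ k ih =>
    rw [Finset.sum_range_succ, orderReady]
    have := le_max_right (x.orderArrival (k + 1)) (x.orderReady k)
    linarith

lemma lt_preparedBefore_iff (ha : ∀ k, 0 < x.orderGap k) (hs : ∀ k, 0 < x.service k)
    (hslim : Tendsto (fun n => ∑ i ∈ Finset.range n, x.service i) atTop atTop) (n : ℕ) (t : ℝ) :
    n < x.preparedBefore t ↔ x.orderReady n < t := by
  have hmono := x.strictMono_orderReady hs
  -- Finiteness is essential: `ncard` of an infinite set would be 0.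
  have hfin : {k : ℕ | x.orderReady k < t}.Finite := by
    obtain ⟨N, hN⟩ := eventually_atTop.1
      ((hslim.comp (tendsto_add_atTop_nat 1)).eventually_ge_atTop t)
    refine (Set.finite_lt_nat N).subset fun k hk => ?_
    by_contra hc
    have h1 : t ≤ ∑ i ∈ Finset.range (k + 1), x.service i := hN k (not_lt.1 hc)
    have h2 : x.orderReady k < t := hk
    linarith [x.sum_service_le_orderReady ha k]
  constructor
  · intro h
    by_contra hc
    have hsub : {k : ℕ | x.orderReady k < t} ⊆ (Finset.range n : Set ℕ) := fun k hk => by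
      have hk : x.orderReady k < t := hk
      simp only [Finset.coe_range, mem_Iio]
      exact hmono.lt_iff_lt.1 (hk.trans_le (not_lt.1 hc))
    have := Set.ncard_le_ncard hsub
    rw [Set.ncard_coe_finset, Finset.card_range] at this
    exact absurd h (not_lt.2 this)
  · intro h
    have hsub : (Finset.range (n + 1) : Set ℕ) ⊆ {k : ℕ | x.orderReady k < t} := fun k hk => by
      simp only [Finset.coe_range, mem_Iio] at hk
      exact (hmono.monotone (Nat.lt_succ_iff.1 hk)).trans_lt h
    have := Set.ncard_le_ncard hsub hfin
    rw [Set.ncard_coe_finset, Finset.card_range] at this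
    exact this

/-- The number of customers of the second queue at time `0`, if `Q₂ + d` is taken for its length:
the number of riders that can still be sent before an order gets ready. -/
def initialCustomers : ℕ := (x.q₂ + x.d).toNat

/-- The arrival times of the customers of the second queue: those initially there, and then the
orders. -/
def customerArrival (m : ℕ) : ℝ :=
  if m < x.initialCustomers then 0 else x.orderReady (m - x.initialCustomers)

lemma customerArrival_add (k : ℕ) :
    x.customerArrival (x.initialCustomers + k) = x.orderReady k := by
  simp [customerArrival]

lemma sentBefore_eq_count [DecidablePred x.Sent] (j : ℕ) :
    x.sentBefore j = Nat.count x.Sent j := by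
  induction j with
  | zero => simp [sentBefore]
  | succ j ih =>
    rw [Nat.count_succ, sentBefore, ← ih]
    have : x.Sent j ↔ -(x.d : ℤ) < x.q₂ + x.preparedBefore (x.dispatchInstant j) - x.sentBefore j :=
      Iff.rfl
    by_cases h : x.Sent j
    · rw [if_pos h, if_pos (this.1 h)]
    · rw [if_neg h, if_neg (fun h' => h (this.2 h')), add_zero]

/-- `Q₂ + d > 0` says that fewer riders have been sent than customers have arrived, so the customer
numbered by the riders sent so far is present. This is the criterion required by
`drawStep_dispatch_iterate`. -/
lemma sent_iff (hq : -(x.d : ℤ) ≤ x.q₂) (ha : ∀ k, 0 < x.orderGap k) (hs : ∀ k, 0 < x.service k)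
    (hr : ∀ k, 0 < x.riderGap k)
    (hslim : Tendsto (fun n => ∑ i ∈ Finset.range n, x.service i) atTop atTop)
    [DecidablePred x.Sent] (j : ℕ) :
    x.Sent j ↔ x.customerArrival (Nat.count x.Sent j) < eventTime x.riderGap j := by
  rw [← x.sentBefore_eq_count j, Sent, queueTwoBefore, customerArrival]
  have hm : (x.initialCustomers : ℤ) = x.q₂ + x.d := Int.toNat_of_nonneg (by linarith)
  have h0 : 0 < eventTime x.riderGap j := Finset.sum_pos (fun _ _ => hr _) (by simp)
  split_ifs with h
  · exact iff_of_true (by omega) h0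
  · rw [← x.lt_preparedBefore_iff ha hs hslim]
    unfold dispatchInstant
    omega

/-- The successive services of the second queue. -/
def secondService : ℕ → ℝ := dispatchService x.customerArrival x.riderGap

/-- The sojourn time of order `k` in the second queue. -/
def secondSojourn (k : ℕ) : ℝ := x.riderArrival (x.initialCustomers + k) - x.orderReady k

lemma secondSojourn_succ (hq : -(x.d : ℤ) ≤ x.q₂) (ha : ∀ k, 0 < x.orderGap k)
    (hs : ∀ k, 0 < x.service k) (hr : ∀ k, 0 < x.riderGap k)
    (hslim : Tendsto (fun n => ∑ i ∈ Finset.range n, x.service i) atTop atTop)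
    (hrlim : Tendsto (fun n => ∑ i ∈ Finset.range n, x.riderGap i) atTop atTop) (k : ℕ) :
    x.secondSojourn (k + 1) =
      max (x.secondSojourn k - (x.orderReady (k + 1) - x.orderReady k)) 0 +
        x.secondService (x.initialCustomers + k + 1) := by
  classical
  have hp := x.sent_iff hq ha hs hr hslim
  have h1 : ∀ i, x.riderArrival i = lastDeparture x.customerArrival x.riderGap (i + 1) := by
    intro i
    obtain ⟨N, -, -, h⟩ := drawStep_dispatch_iterate hr hrlim hp i
    rw [h]; rfl
  have h2 := lastDeparture_succ hr hrlim hp (x.initialCustomers + (k + 1))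
  rw [← h1, x.customerArrival_add, ← add_assoc, ← h1] at h2
  rw [secondSojourn, secondSojourn, secondService, ← add_assoc, h2]
  rcases le_total (x.orderReady (k + 1)) (x.riderArrival (x.initialCustomers + k)) with h | h
  · rw [max_eq_right h, max_eq_left (by linarith)]; ring
  · rw [max_eq_left h, max_eq_right (by linarith)]; ring

/-- Order `k + d` is taken by rider `k + d + q₂`, whose arrival is the departure of order `k` as a
customer of the second queue. This shift by `d` is the effect of the buffer. -/
lemma orderWaiting_add (hq : -(x.d : ℤ) ≤ x.q₂) (k : ℕ) :
    x.orderWaiting (k + x.d) = x.orderReady (k + x.d) - x.orderArrival (k + x.d) +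
      max (x.secondSojourn k - (x.orderReady (k + x.d) - x.orderReady k)) 0 := by
  have hm : (x.initialCustomers : ℤ) = x.q₂ + x.d := Int.toNat_of_nonneg (by linarith)
  have h1 : ¬ (((k + x.d : ℕ) : ℤ) + x.q₂ < 0) := by push_cast; omega
  have h2 : (((k + x.d : ℕ) : ℤ) + x.q₂).toNat = x.initialCustomers + k := by omega
  rw [orderWaiting, orderFetched, riderOfOrderArrival, if_neg h1, h2, secondSojourn]
  rcases le_total (x.orderReady (k + x.d)) (x.riderArrival (x.initialCustomers + k)) with h | h
  · rw [max_eq_right h, max_eq_left (by linarith)]; ring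
  · rw [max_eq_left h, max_eq_right (by linarith)]; ring

lemma riderWaiting_add (hq : -(x.d : ℤ) ≤ x.q₂) (k : ℕ) :
    x.riderWaiting (x.initialCustomers + k) =
      max (x.orderReady (k + x.d) - x.orderReady k - x.secondSojourn k) 0 := by
  have hm : (x.initialCustomers : ℤ) = x.q₂ + x.d := Int.toNat_of_nonneg (by linarith)
  have h1 : ¬ (((x.initialCustomers + k : ℕ) : ℤ) - x.q₂ < 0) := by push_cast; omega
  have h2 : (((x.initialCustomers + k : ℕ) : ℤ) - x.q₂).toNat = k + x.d := by omega
  rw [riderWaiting, riderFetch, if_neg h1, h2, secondSojourn]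
  rcases le_total (x.orderReady (k + x.d)) (x.riderArrival (x.initialCustomers + k)) with h | h
  · rw [max_eq_right h, max_eq_right (by linarith)]; ring
  · rw [max_eq_left h, max_eq_left (by linarith)]; ring

/-! ### Coupling with stationary queues -/

/-- The first queue with initial sojourn time `w`. -/
def firstQueue (w : ℝ) : ℝ × (ℕ → ℝ × ℝ) :=
  (w, zipSeq (x.orderGap, shiftSeq x.q₁ x.service))

/-- The second queue with initial sojourn time `v`, where the arrivals are the departures of the
first queue with initial sojourn time `w`. -/
def secondQueue (w v : ℝ) : ℝ × (ℕ → ℝ × ℝ) :=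
  (v, zipSeq (fun i => departureGap (queueStep^[i] (x.firstQueue w)),
    shiftSeq (x.initialCustomers + x.q₁) x.secondService))

variable {x}

/-- The merging is used twice: the first queues merge, after which their departure gaps agree; then
the second queues satisfy the same recursion and merge as well. The indices `i + 1` come from the
convention that index 0 stands for the initial state. -/
theorem eventually_coupled {w v : ℝ} (hq : -(x.d : ℤ) ≤ x.q₂)
    (ha : ∀ k, 0 < x.orderGap k) (hs : ∀ k, 0 < x.service k) (hr : ∀ k, 0 < x.riderGap k)
    (hslim : Tendsto (fun n => ∑ i ∈ Finset.range n, x.service i) atTop atTop)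
    (hrlim : Tendsto (fun n => ∑ i ∈ Finset.range n, x.riderGap i) atTop atTop)
    (h₁ : Tendsto (fun n => ∑ i ∈ Finset.range n,
      (((x.firstQueue w).2 i).2 - ((x.firstQueue w).2 i).1)) atTop atBot)
    (h₂ : Tendsto (fun n => ∑ i ∈ Finset.range n,
      (((x.secondQueue w v).2 i).2 - ((x.secondQueue w v).2 i).1)) atTop atBot) :
    ∀ᶠ i in atTop,
      x.orderReady (x.q₁ + i) - x.orderArrival (x.q₁ + i) = sojourn (x.firstQueue w) (i + 1) ∧
      x.orderReady (x.q₁ + i + x.d) - x.orderReady (x.q₁ + i) =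
        gapSum x.d (shiftSeq (i + 1) (x.secondQueue w v).2) ∧
      x.secondSojourn (x.q₁ + i) = sojourn (x.secondQueue w v) (i + 1) := by
  set y := x.firstQueue w with hy
  set z := x.secondQueue w v with hz
  have e1 : ∀ᶠ i in atTop, lindley (∑ k ∈ Finset.range x.q₁, x.service k) x.orderGap
      (shiftSeq x.q₁ x.service) i = sojourn y i :=
    eventually_eq_of_lindley (.of_forall fun i => (ha i).le) h₁ (.of_forall fun _ => rfl)
      (.of_forall fun _ => rfl)
  have hgap : ∀ i, (z.2 i).1 = x.service (x.q₁ + i) + max (x.orderGap i - sojourn y i) 0 := by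
    intro i
    simp only [hz, secondQueue, zipSeq, ← hy, queueStep_iterate, departureGap]
    rfl
  have e2 : ∀ᶠ i in atTop, x.orderReady (x.q₁ + i) - x.orderArrival (x.q₁ + i)
      = sojourn y (i + 1) := by
    filter_upwards [(tendsto_add_atTop_nat 1).eventually e1] with i hi
    rw [x.orderReady_add ha hs, hi, x.orderArrival_add]
    ring
  have e3 : ∀ᶠ i in atTop, x.orderReady (x.q₁ + i + 1) - x.orderReady (x.q₁ + i)
      = (z.2 (i + 1)).1 := by
    filter_upwards [e2, (tendsto_add_atTop_nat 1).eventually e2] with i hi hi'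
    rw [x.orderArrival_add] at hi hi'
    have h1 : eventTime x.orderGap (i + 1) = eventTime x.orderGap i + x.orderGap (i + 1) :=
      Finset.sum_range_succ _ _
    have h2 : sojourn y (i + 1 + 1)
        = max (sojourn y (i + 1) - x.orderGap (i + 1)) 0 + x.service (x.q₁ + (i + 1)) := rfl
    rw [hgap, add_assoc]
    rcases le_total (sojourn y (i + 1)) (x.orderGap (i + 1)) with h | h
    · rw [max_eq_right (by linarith)] at h2
      rw [max_eq_left (by linarith)]
      linarith
    · rw [max_eq_left (by linarith)] at h2
      rw [max_eq_right (by linarith)]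
      linarith
  have e4 : ∀ᶠ i in atTop, x.secondSojourn (x.q₁ + i) = sojourn z (i + 1) := by
    refine eventually_eq_of_lindley (a := fun i => (z.2 (i + 1)).1) (s := fun i => (z.2 (i + 1)).2)
      (.of_forall fun i => ?_) ?_ ?_ (.of_forall fun i => rfl)
    · simp only [hgap]
      exact add_nonneg (hs _).le (le_max_right _ _)
    · have h3 := tendsto_atBot_add_const_right atTop (-((z.2 0).2 - (z.2 0).1))
        (h₂.comp (tendsto_add_atTop_nat 1))
      refine h3.congr fun n => ?_
      simp only [Function.comp]
      rw [Finset.sum_range_succ']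
      ring
    · filter_upwards [e3] with i hi
      rw [← hi, ← add_assoc, x.secondSojourn_succ hq ha hs hr hslim hrlim]
      congr 1
      simp only [hz, secondQueue, zipSeq, shiftSeq_apply]
      congr 1
      ring
  obtain ⟨N, hN⟩ := eventually_atTop.1 e3
  have e5 : ∀ᶠ i in atTop, x.orderReady (x.q₁ + i + x.d) - x.orderReady (x.q₁ + i) =
        gapSum x.d (shiftSeq (i + 1) z.2) := by
    filter_upwards [eventually_ge_atTop N] with i hi
    have h : ∀ n, x.orderReady (x.q₁ + i + n) - x.orderReady (x.q₁ + i) =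
        gapSum n (shiftSeq (i + 1) z.2) := by
      intro n
      induction n with
      | zero => simp [gapSum]
      | succ n ih =>
        have h1 := hN (i + n) (by omega)
        rw [gapSum, Finset.sum_range_succ, ← gapSum, ← ih, shiftSeq_apply,
          show i + 1 + n = i + n + 1 by ring, ← h1, ← add_assoc, ← add_assoc]
        ring
    exact h x.d
  filter_upwards [e2, e5, e4] with i a b c using ⟨a, b, c⟩

/-- The waiting of order `k + d` is its sojourn in the first queue plus a term of the second queue
indexed by `k`. Averages ignore the shift, and they add without any independence. -/
theorem longRunAverage_of_coupled {w v L₁ L₂ L₃ : ℝ} (hq : -(x.d : ℤ) ≤ x.q₂)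
    (hs : ∀ k, 0 < x.service k)
    (h : ∀ᶠ i in atTop,
      x.orderReady (x.q₁ + i) - x.orderArrival (x.q₁ + i) = sojourn (x.firstQueue w) (i + 1) ∧
      x.orderReady (x.q₁ + i + x.d) - x.orderReady (x.q₁ + i) =
        gapSum x.d (shiftSeq (i + 1) (x.secondQueue w v).2) ∧
      x.secondSojourn (x.q₁ + i) = sojourn (x.secondQueue w v) (i + 1))
    (h₁ : HasLongRunAverage (fun i => remaining 0
      (sojourn (x.firstQueue w) i, shiftSeq i (x.firstQueue w).2)) L₁)
    (h₂ : HasLongRunAverage (fun i => remaining x.d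
      (sojourn (x.secondQueue w v) i, shiftSeq i (x.secondQueue w v).2)) L₂)
    (h₃ : HasLongRunAverage (fun i => leadTime x.d
      (sojourn (x.secondQueue w v) i, shiftSeq i (x.secondQueue w v).2)) L₃) :
    HasLongRunAverage x.orderWaiting (L₁ + L₂) ∧ HasLongRunAverage x.riderWaiting L₃ := by
  constructor
  · have a1 : HasLongRunAverage (fun i => sojourn (x.firstQueue w) (i + x.d + 1)) L₁ := by
      refine h₁.of_eventually_shift_eq 0 (x.d + 1) (.of_forall fun i => ?_)
      -- Only indices at least 1 are used: the initial value `w` is arbitrary and may be negative.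
      have h1 : 0 ≤ sojourn (x.firstQueue w) (x.d + 1 + i) := by
        rw [show x.d + 1 + i = x.d + i + 1 by ring]
        exact add_nonneg (le_max_right _ _) (hs _).le
      have h2 : 0 + i + x.d + 1 = x.d + 1 + i := by ring
      simp only [remaining, gapSum, Finset.range_zero, Finset.sum_empty, sub_zero, h2]
      rw [max_eq_left h1]
    have a2 : HasLongRunAverage (fun i => remaining x.d
      (sojourn (x.secondQueue w v) (i + 1), shiftSeq (i + 1) (x.secondQueue w v).2)) L₂ := by
      refine h₂.of_eventually_shift_eq 0 1 (.of_forall fun i => ?_)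
      rw [zero_add, add_comm]
    refine (a1.add a2).of_eventually_shift_eq (x.q₁ + x.d) 0 ?_
    filter_upwards [h, (tendsto_add_atTop_nat x.d).eventually h] with i hi hi'
    have e : x.q₁ + x.d + i = x.q₁ + i + x.d := by ring
    rw [e, x.orderWaiting_add hq, zero_add, hi.2.1, hi.2.2, remaining, ← hi'.1, ← add_assoc]
  · refine h₃.of_eventually_shift_eq (x.initialCustomers + x.q₁) 1 ?_
    filter_upwards [h] with i hi
    rw [add_assoc, x.riderWaiting_add hq, hi.2.1, hi.2.2, leadTime, add_comm 1]

end Realization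

/-! ### The random input -/

lemma indepFun_inl_inr {Ω ι κ E : Type*} [MeasurableSpace Ω] [MeasurableSpace E]
    {P : Measure Ω} {F : ι ⊕ κ → Ω → E} (hF : iIndepFun F P) (hm : ∀ i, AEMeasurable (F i) P) :
    IndepFun (fun ω i => F (Sum.inl i) ω) (fun ω j => F (Sum.inr j) ω) P := by
  have := hF.isProbabilityMeasure
  refine IndepFun.process_indepFun_process₀ (𝓧 := fun _ : ι => E) (𝓨 := fun _ : κ => E)
    (fun i => hm _) (fun j => hm _) fun I J => ?_
  have hd : Disjoint (I.map Function.Embedding.inl) (J.map Function.Embedding.inr) := by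
    rw [Finset.disjoint_left]
    intro a ha hb
    simp only [Finset.mem_map, Function.Embedding.inl_apply, Function.Embedding.inr_apply] at ha hb
    obtain ⟨i, -, rfl⟩ := ha
    obtain ⟨j, -, h⟩ := hb
    exact absurd h (by simp)
  exact (hF.indepFun_finset₀ _ _ hd hm).comp
    (φ := fun (z : (I.map (Function.Embedding.inl (α := ι) (β := κ)) : Finset _) → E) (i : I) =>
      z ⟨Sum.inl i, by simp⟩)
    (ψ := fun (z : (J.map (Function.Embedding.inr (α := ι) (β := κ)) : Finset _) → E) (j : J) =>
      z ⟨Sum.inr j, by simp⟩) (by fun_prop) (by fun_prop)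

lemma hasLaw_prodMk_of_indepFun {Ω E F : Type*} [MeasurableSpace Ω] [MeasurableSpace E]
    [MeasurableSpace F] {P : Measure Ω} [IsProbabilityMeasure P] {X : Ω → E} {Y : Ω → F}
    {m : Measure E} {n : Measure F} (hX : HasLaw X m P) (hY : HasLaw Y n P)
    (h : IndepFun X Y P) : HasLaw (fun ω => (X ω, Y ω)) (m.prod n) P := by
  refine ⟨hX.aemeasurable.prodMk hY.aemeasurable, ?_⟩
  rw [(indepFun_iff_map_prod_eq_prod_map_map hX.aemeasurable hY.aemeasurable).1 h, hX.map_eq,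
    hY.map_eq]

lemma hasLaw_input {Ω : Type*} [MeasurableSpace Ω] {P : Measure Ω} [IsProbabilityMeasure P]
    {a b c : Measure ℝ} [IsProbabilityMeasure a] [IsProbabilityMeasure b] [IsProbabilityMeasure c]
    {A S R : ℕ → Ω → ℝ} (hA : ∀ k, HasLaw (A k) a P) (hS : ∀ k, HasLaw (S k) b P)
    (hR : ∀ k, HasLaw (R k) c P) (hindep : iIndepFun (Sum.elim A (Sum.elim S R)) P) :
    HasLaw (fun ω => (((fun k => A k ω), (fun k => S k ω)), (fun k => R k ω)))
      (((iidLaw a).prod (iidLaw b)).prod (iidLaw c)) P := by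
  have hm : ∀ i, AEMeasurable (Sum.elim A (Sum.elim S R) i) P := by
    rintro (i | i | i)
    exacts [(hA i).aemeasurable, (hS i).aemeasurable, (hR i).aemeasurable]
  have hSR : iIndepFun (Sum.elim S R) P := hindep.precomp (g := Sum.inr) Sum.inr_injective
  have i1 := indepFun_inl_inr hindep hm
  have i2 := indepFun_inl_inr hSR fun i => hm (Sum.inr i)
  have lA : HasLaw (fun ω k => A k ω) (iidLaw a) P :=
    (hindep.precomp (g := Sum.inl) Sum.inl_injective).hasLaw_infinitePi hA
      (aemeasurable_pi_lambda _ fun k => (hA k).aemeasurable)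
  have lS : HasLaw (fun ω k => S k ω) (iidLaw b) P :=
    (hSR.precomp (g := Sum.inl) Sum.inl_injective).hasLaw_infinitePi hS
      (aemeasurable_pi_lambda _ fun k => (hS k).aemeasurable)
  have lR : HasLaw (fun ω k => R k ω) (iidLaw c) P :=
    (hSR.precomp (g := Sum.inr) Sum.inr_injective).hasLaw_infinitePi hR
      (aemeasurable_pi_lambda _ fun k => (hR k).aemeasurable)
  have lSR := hasLaw_prodMk_of_indepFun lS lR i2
  have i3 : IndepFun (fun ω k => A k ω) (fun ω => ((fun k => S k ω), (fun k => R k ω))) P :=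
    i1.comp (φ := id) (ψ := fun z : ℕ ⊕ ℕ → ℝ => ((fun k => z (Sum.inl k)), fun k => z (Sum.inr k)))
      measurable_id (by fun_prop)
  exact (measurePreserving_prodAssoc _ _ _).symm.comp_hasLaw (hasLaw_prodMk_of_indepFun lA lSR i3)

/-! ### Laws of the coupled queues and the almost sure averages -/

namespace Realization

lemma measurable_orderReady (d q₁ : ℕ) (q₂ : ℤ) (r : ℕ → ℝ) (k : ℕ) :
    Measurable fun p : (ℕ → ℝ) × (ℕ → ℝ) => orderReady ⟨d, q₁, q₂, p.1, p.2, r⟩ k := by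
  have h : ∀ k, Measurable fun p : (ℕ → ℝ) × (ℕ → ℝ) =>
      orderArrival ⟨d, q₁, q₂, p.1, p.2, r⟩ k := fun k => by
    by_cases hk : k < q₁
    · simp only [orderArrival, hk, if_true]; fun_prop
    · simp only [orderArrival, hk, if_false]
      exact (measurable_eventTime _).comp measurable_fst
  induction k with
  | zero =>
    simp only [orderReady]
    exact (h 0).add (by fun_prop)
  | succ k ih =>
    simp only [orderReady]
    exact ((h (k + 1)).max ih).add (by fun_prop)

lemma measurable_customerArrival (d q₁ : ℕ) (q₂ : ℤ) (r : ℕ → ℝ) :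
    Measurable fun p : (ℕ → ℝ) × (ℕ → ℝ) => customerArrival ⟨d, q₁, q₂, p.1, p.2, r⟩ := by
  refine measurable_pi_lambda _ fun m => ?_
  by_cases hm : m < (q₂ + d).toNat
  · simp only [customerArrival, initialCustomers, hm, if_true]; fun_prop
  · simp only [customerArrival, initialCustomers, hm, if_false]
    exact measurable_orderReady d q₁ q₂ r _

/-- This allows the rider gaps to be replaced by 0, so that the customer arrivals are a function of
the order clocks alone. -/
lemma customerArrival_riderGap (d q₁ : ℕ) (q₂ : ℤ) (a s r r' : ℕ → ℝ) :
    customerArrival ⟨d, q₁, q₂, a, s, r⟩ = customerArrival ⟨d, q₁, q₂, a, s, r'⟩ := by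
  have h : ∀ k, orderReady ⟨d, q₁, q₂, a, s, r⟩ k = orderReady ⟨d, q₁, q₂, a, s, r'⟩ k := fun k => by
    induction k with
    | zero => rfl
    | succ k ih => rw [orderReady, orderReady, ih]; rfl
  funext m
  unfold customerArrival
  rw [h]
  rfl

variable (μ l₀ : ℝ) [Fact (1 < μ)] [Fact (1 < l₀)] (d q₁ : ℕ) (q₂ : ℤ)

/-- The law of the initial sojourn times and the three sequences of clocks. -/
abbrev extendedLaw : Measure (((ℝ × ((ℕ → ℝ) × (ℕ → ℝ))) × (ℕ → ℝ)) × ℝ) :=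
  (((expMeasure (μ - 1)).prod ((iidLaw (expMeasure 1)).prod (iidLaw (expMeasure μ)))).prod
    (iidLaw (expMeasure l₀))).prod (expMeasure (l₀ - 1))

lemma measurePreserving_firstQueue (r : ℕ → ℝ) : MeasurePreserving
    (fun y : ℝ × ((ℕ → ℝ) × (ℕ → ℝ)) => firstQueue ⟨d, q₁, q₂, y.2.1, y.2.2, r⟩ y.1)
    ((expMeasure (μ - 1)).prod ((iidLaw (expMeasure 1)).prod (iidLaw (expMeasure μ))))
    (queueLaw μ) :=
  (MeasurePreserving.id _).prod ((measurePreserving_zipSeq _ _).comp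
    ((MeasurePreserving.id _).prod (measurePreserving_shiftSeq _ q₁)))

/-- For fixed first-queue data the dispatch services have a law that does not depend on these data.
So the skew product preserves the product measure, and the services are independent of the departure
gaps of the stationary first queue, although they are built from the arrivals of the actual one. -/
lemma measurePreserving_secondQueue : MeasurePreserving
    (fun q : ((ℝ × ((ℕ → ℝ) × (ℕ → ℝ))) × (ℕ → ℝ)) × ℝ =>
      secondQueue ⟨d, q₁, q₂, q.1.1.2.1, q.1.1.2.2, q.1.2⟩ q.1.1.1 q.2)
    (extendedLaw μ l₀) (queueLaw l₀) := by
  have hl : 0 < l₀ := by have : 1 < l₀ := Fact.out; linarith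
  set ν := (expMeasure (μ - 1)).prod ((iidLaw (expMeasure 1)).prod (iidLaw (expMeasure μ)))
  have h1 : MeasurePreserving (fun p : (ℝ × ((ℕ → ℝ) × (ℕ → ℝ))) × (ℕ → ℝ) =>
      (p.1, dispatchService (customerArrival ⟨d, q₁, q₂, p.1.2.1, p.1.2.2, 0⟩) p.2))
      (ν.prod (iidLaw (expMeasure l₀))) (ν.prod (iidLaw (expMeasure l₀))) := by
    refine (MeasurePreserving.id ν).skew_product
      (g := fun y r => dispatchService (customerArrival ⟨d, q₁, q₂, y.2.1, y.2.2, 0⟩) r) ?_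
      (ae_of_all _ fun y => (measurePreserving_dispatchService hl _).map_eq)
    have hc : Measurable fun p : (ℝ × ((ℕ → ℝ) × (ℕ → ℝ))) × (ℕ → ℝ) =>
        customerArrival ⟨d, q₁, q₂, p.1.2.1, p.1.2.2, 0⟩ :=
      (measurable_customerArrival d q₁ q₂ 0).comp (measurable_snd.comp measurable_fst)
    have hg := measurable_dispatchService.comp (hc.prodMk measurable_snd)
    simp only [Function.comp_def] at hg
    exact hg
  have h2 : MeasurePreserving
      (fun (y : ℝ × ((ℕ → ℝ) × (ℕ → ℝ))) i =>
        departureGap (queueStep^[i] (firstQueue ⟨d, q₁, q₂, y.2.1, y.2.2, 0⟩ y.1))) ν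
      (iidLaw (expMeasure 1)) :=
    (measurePreserving_departureGaps μ).comp (measurePreserving_firstQueue μ d q₁ q₂ 0)
  have h3 := (measurePreserving_zipSeq (expMeasure 1) (expMeasure l₀)).comp
    ((h2.prod (measurePreserving_shiftSeq (expMeasure l₀) ((q₂ + d).toNat + q₁))).comp h1)
  have h4 := Measure.measurePreserving_swap.comp
    (h3.prod (MeasurePreserving.id (expMeasure (l₀ - 1))))
  have h5 : (fun q : ((ℝ × ((ℕ → ℝ) × (ℕ → ℝ))) × (ℕ → ℝ)) × ℝ =>
      secondQueue ⟨d, q₁, q₂, q.1.1.2.1, q.1.1.2.2, q.1.2⟩ q.1.1.1 q.2) = fun q => (q.2, zipSeq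
      ((fun i => departureGap (queueStep^[i] (firstQueue ⟨d, q₁, q₂, q.1.1.2.1, q.1.1.2.2, 0⟩
        q.1.1.1))), shiftSeq ((q₂ + d).toNat + q₁)
        (dispatchService (customerArrival ⟨d, q₁, q₂, q.1.1.2.1, q.1.1.2.2, 0⟩) q.1.2))) := by
    funext q
    rw [secondQueue, secondService, customerArrival_riderGap d q₁ q₂ _ _ _ 0]
    rfl
  rw [h5]
  exact h4

lemma measurePreserving_extend : MeasurePreserving
    (fun q : ((((ℕ → ℝ) × (ℕ → ℝ)) × (ℕ → ℝ)) × (ℝ × ℝ)) =>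
      (((q.2.1, q.1.1), q.1.2), q.2.2))
    ((((iidLaw (expMeasure 1)).prod (iidLaw (expMeasure μ))).prod (iidLaw (expMeasure l₀))).prod
      ((expMeasure (μ - 1)).prod (expMeasure (l₀ - 1)))) (extendedLaw μ l₀) := by
  set as := (iidLaw (expMeasure 1)).prod (iidLaw (expMeasure μ))
  set r := iidLaw (expMeasure l₀)
  set w := expMeasure (μ - 1)
  set v := expMeasure (l₀ - 1)
  have h1 := (measurePreserving_prodAssoc (as.prod r) w v).symm
  have h2 := measurePreserving_prodAssoc as r w
  have h3 := (MeasurePreserving.id as).prod (Measure.measurePreserving_swap (μ := r) (ν := w))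
  have h4 := (measurePreserving_prodAssoc as w r).symm
  have h5 := (Measure.measurePreserving_swap (μ := as) (ν := w)).prod (MeasurePreserving.id r)
  exact ((h5.comp (h4.comp (h3.comp h2))).prod (MeasurePreserving.id v)).comp h1

lemma ae_iid_exp_pos {r : ℝ} (hr : 0 < r) [IsProbabilityMeasure (expMeasure r)] :
    ∀ᵐ x ∂(iidLaw (expMeasure r)), ∀ k, 0 < x k :=
  ae_all_iff.2 fun k =>
    (measurePreserving_eval_iid _ k).quasiMeasurePreserving.ae (expMeasure_ae_pos hr)

theorem ae_longRunAverage (hq : -(d : ℤ) ≤ q₂) :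
    ∀ᵐ p ∂(((iidLaw (expMeasure 1)).prod (iidLaw (expMeasure μ))).prod
        (iidLaw (expMeasure l₀))),
      HasLongRunAverage (orderWaiting ⟨d, q₁, q₂, p.1.1, p.1.2, p.2⟩)
        ((1 / μ) ^ 0 / (μ - 1) + (1 / l₀) ^ d / (l₀ - 1)) ∧
      HasLongRunAverage (riderWaiting ⟨d, q₁, q₂, p.1.1, p.1.2, p.2⟩)
        ((1 / l₀) ^ d / (l₀ - 1) - 1 / (l₀ - 1) + d) := by
  have hμ : 0 < μ := by have : 1 < μ := Fact.out; linarith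
  have hl : 0 < l₀ := by have : 1 < l₀ := Fact.out; linarith
  set ν := (expMeasure (μ - 1)).prod ((iidLaw (expMeasure 1)).prod (iidLaw (expMeasure μ))) with hν
  have pY : MeasurePreserving (fun q => q.1.1) (extendedLaw μ l₀) ν :=
    measurePreserving_fst.comp measurePreserving_fst
  have pA : MeasurePreserving (fun q => q.1.1.2.1) (extendedLaw μ l₀) (iidLaw (expMeasure 1)) :=
    measurePreserving_fst.comp (measurePreserving_snd.comp pY)
  have pS : MeasurePreserving (fun q => q.1.1.2.2) (extendedLaw μ l₀) (iidLaw (expMeasure μ)) :=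
    measurePreserving_snd.comp (measurePreserving_snd.comp pY)
  have pR : MeasurePreserving (fun q => q.1.2) (extendedLaw μ l₀) (iidLaw (expMeasure l₀)) :=
    measurePreserving_snd.comp measurePreserving_fst
  have p1 := (measurePreserving_firstQueue μ d q₁ q₂ 0).comp pY
  have p2 := measurePreserving_secondQueue μ l₀ d q₁ q₂
  have s1 : MeasurePreserving Prod.snd (queueLaw μ)
    (iidLaw ((expMeasure 1).prod (expMeasure μ))) := measurePreserving_snd
  have s2 : MeasurePreserving Prod.snd (queueLaw l₀)
    (iidLaw ((expMeasure 1).prod (expMeasure l₀))) := measurePreserving_snd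
  have key : ∀ᵐ q ∂(extendedLaw μ l₀),
      HasLongRunAverage (orderWaiting ⟨d, q₁, q₂, q.1.1.2.1, q.1.1.2.2, q.1.2⟩)
        ((1 / μ) ^ 0 / (μ - 1) + (1 / l₀) ^ d / (l₀ - 1)) ∧
      HasLongRunAverage (riderWaiting ⟨d, q₁, q₂, q.1.1.2.1, q.1.1.2.2, q.1.2⟩)
        ((1 / l₀) ^ d / (l₀ - 1) - 1 / (l₀ - 1) + d) := by
    filter_upwards [pA.quasiMeasurePreserving.ae (ae_iid_exp_pos one_pos),
      pS.quasiMeasurePreserving.ae (ae_iid_exp_pos hμ),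
      pR.quasiMeasurePreserving.ae (ae_iid_exp_pos hl),
      pS.quasiMeasurePreserving.ae (ae_tendsto_sum_atTop hμ),
      pR.quasiMeasurePreserving.ae (ae_tendsto_sum_atTop hl),
      (s1.comp p1).quasiMeasurePreserving.ae (ae_sum_service_sub_gap_tendsto μ),
      (s2.comp p2).quasiMeasurePreserving.ae (ae_sum_service_sub_gap_tendsto l₀),
      p1.quasiMeasurePreserving.ae (ae_longRunAverage_remaining μ 0),
      p2.quasiMeasurePreserving.ae (ae_longRunAverage_remaining l₀ d),
      p2.quasiMeasurePreserving.ae (ae_longRunAverage_leadTime l₀ d)]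
      with q ha hs hr hslim hrlim h1 h2 a1 a2 a3
    exact longRunAverage_of_coupled (x := ⟨d, q₁, q₂, q.1.1.2.1, q.1.1.2.2, q.1.2⟩) hq hs
      (eventually_coupled (w := q.1.1.1) (v := q.2) hq ha hs hr hslim hrlim h1 h2) a1 a2 a3
  -- The auxiliary sojourn times `w` and `v` do not occur in the conclusion: for almost every input,
  -- almost all of them work, so one pair exists and is enough.
  have h := Measure.ae_ae_of_ae_prod
    ((measurePreserving_extend μ l₀).quasiMeasurePreserving.ae key)
  filter_upwards [h] with p hp
  exact hp.exists.choose_spec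

end Realization

end MealDelivery

end

theorem mainTheorem5 {Ω : Type*} [MeasurableSpace Ω] (P : Measure Ω) [IsProbabilityMeasure P]
    (μ l₀ ρ : ℝ) (hμ : 1 < μ) (hl₀ : 1 < l₀) (hρ : ρ = 1 / l₀)
    (d q₁ : ℕ) (q₂ : ℤ) (hq₂ : -(d : ℤ) ≤ q₂)
    (A S R : ℕ → Ω → ℝ)
    (hA : ∀ k, HasLaw (A k) (expMeasure 1) P)
    (hS : ∀ k, HasLaw (S k) (expMeasure μ) P)
    (hR : ∀ k, HasLaw (R k) (expMeasure l₀) P)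
    (hindep : iIndepFun (Sum.elim A (Sum.elim S R)) P) :
    (∀ᵐ ω ∂P, MealDelivery.HasLongRunAverage
      (MealDelivery.Realization.orderWaiting
        ⟨d, q₁, q₂, fun k => A k ω, fun k => S k ω, fun k => R k ω⟩)
      (1 / (μ - 1) + ρ ^ (d + 1) / (1 - ρ))) ∧
    (∀ᵐ ω ∂P, MealDelivery.HasLongRunAverage
      (MealDelivery.Realization.riderWaiting
        ⟨d, q₁, q₂, fun k => A k ω, fun k => S k ω, fun k => R k ω⟩)
      ((d : ℝ) - (ρ - ρ ^ (d + 1)) / (1 - ρ))) := by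
  have : Fact (1 < μ) := ⟨hμ⟩
  have : Fact (1 < l₀) := ⟨hl₀⟩
  have hl0 : l₀ ≠ 0 := by positivity
  have hl1 : l₀ - 1 ≠ 0 := by linarith
  have hμ1 : μ - 1 ≠ 0 := by linarith
  -- This turns `ρ ^ d / (l₀ - 1)` into `ρ ^ (d + 1) / (1 - ρ)`.
  have hρ1 : 1 - ρ = (l₀ - 1) * ρ := by rw [hρ]; field_simp
  have hρ0 : ρ ≠ 0 := by rw [hρ]; positivity
  have hlaw := MealDelivery.hasLaw_input hA hS hR hindep
  have h := MealDelivery.Realization.ae_longRunAverage μ l₀ d q₁ q₂ hq₂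
  rw [← hlaw.map_eq] at h
  have h' := ae_of_ae_map hlaw.aemeasurable h
  rw [← hρ] at h'
  have e1 : (1 / μ) ^ 0 / (μ - 1) + ρ ^ d / (l₀ - 1) = 1 / (μ - 1) + ρ ^ (d + 1) / (1 - ρ) := by
    rw [hρ1]; field_simp; ring
  have e2 : ρ ^ d / (l₀ - 1) - 1 / (l₀ - 1) + d = (d : ℝ) - (ρ - ρ ^ (d + 1)) / (1 - ρ) := by
    rw [hρ1]; field_simp; ring
  rw [e1, e2] at h'
  exact ⟨h'.mono fun ω h => h.1, h'.mono fun ω h => h.2⟩
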